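/- Let $R>0$ and $n\in\mathbb{N}$, let $h$ be a real continuous function on $[-R,R]^n$ and let $\mu_1,\dots,\mu_n$ be Borel probability measures on $[-R,R]$. Write $P(h):=\log\int_{[-R,R]^n}e^{h(\mathbf x)}\,d\mathbf x$ for the pressure of $h$, and let the Gibbs measure associated with a real continuous function $g$ on $[-R,R]^m$ be the probability measure with density $e^{g}/\int_{[-R,R]^m} e^{g}\,d\mathbf x$ with respect to Lebesgue measure. The Boltzmann–Gibbs entropy of a probability measure $\nu$ on $[-R,R]$ is $H(\nu):=-\int_{-R}^{R} p\log p\,dx\in[-\infty,\infty)$ if $\nu$ has a density $p$ with respect to Lebesgue measure, and $H(\nu):=-\infty$ otherwise. An approximating sequence for $(\mu_1,\dots,\mu_n)$ consists of vectors $\xi_i(N)\in[-R,R]^N$ ($1\le i\le n$, $N\in\mathbb{N}$) with increasing coordinates $\xi_i(N)_1\le\dots\le\xi_i(N)_N$ such that $\frac1N\sum_{j=1}^N \xi_i(N)_j^k\to\int x^k\,d\mu_i(x)$ as $N\to\infty$ for all $k\in\mathbb{N}$ and all $i$. Such sequences exist. For any approximating sequence, define the mutual pressure $$ P_{\mathrm{sym}}(h:\mu_1,\dots,\mu_n):=\limsup_{N\to\infty}\frac1N\log\Biggl[\frac1{(N!)^n}\sum_{\sigma_1,\dots,\sigma_n\in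 S_N}\exp\Bigl(\sum_{j=1}^N h\bigl(\xi_1(N)_{\sigma_1^{-1}(j)},\dots,\xi_n(N)_{\sigma_n^{-1}(j)}\bigr)\Bigr)\Biggr]. $$ Then, for every choice of the approximating sequence, $$ P(h)\ge P_{\mathrm{sym}}(h:\mu_1,\dots,\mu_n)+\sum_{i=1}^nH(\mu_i). $$ Moreover the following conditions are equivalent: (i) $P(h)=P_{\mathrm{sym}}(h:\mu_1,\dots,\mu_n)+\sum_{i=1}^nH(\mu_i)$; (ii) $\mu_1,\dots,\mu_n$ are the marginals of the Gibbs measure associated with $h$; (iii) for each $i=1,\dots,n$, $\mu_i$ is the Gibbs measure associated with the function $h_i$ on $[-R,R]$ (which is continuous) defined by $$ h_i(x):=\log\int_{[-R,R]^{n-1}}e^{h(x_1,\dots,x_{i-1},x,x_{i+1},\dots,x_n)}\,dx_1\cdots dx_{i-1}\,dx_{i+1}\cdots dx_n . $$ -/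

import Mathlib

open MeasureTheory Filter Topology

noncomputable section

/-- The interval `[-R, R]`. -/
abbrev SymInterval (R : ℝ) : Type := Set.Icc (-R) R

/-- Lebesgue measure on `[-R, R]`. The cube `Fin n → SymInterval R` then carries the product
measure, i.e. `n`-dimensional Lebesgue measure. -/
instance SymInterval.measureSpace (R : ℝ) : MeasureSpace (SymInterval R) where
  volume := Measure.comap Subtype.val volume

/-- The Boltzmann–Gibbs entropy `H(μ) = -∫ p log p dx` of a probability measure on `[-R, R]` with
density `p`, and `-∞` if `μ` has no density. As `p log p` is bounded below on a set of finite
Lebesgue measure, its integral always exists in `(-∞, +∞]`; it is `+∞`, so that `H(μ) = -∞`,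
exactly when `p log p` is not integrable. -/
def entropy {R : ℝ} (μ : ProbabilityMeasure (SymInterval R)) : EReal :=
  open Classical in
  let p : SymInterval R → ℝ := fun x => ((μ : Measure (SymInterval R)).rnDeriv volume x).toReal
  if (μ : Measure (SymInterval R)) ≪ volume ∧
      Integrable (fun x => p x * Real.log (p x)) volume then
    ((-∫ x, p x * Real.log (p x) : ℝ) : EReal)
  else ⊥

/-- The pressure `P(h) = log ∫ e^h dx` on the cube `[-R, R]^n`. -/
def pressure {R : ℝ} {n : ℕ} (h : C(Fin n → SymInterval R, ℝ)) : ℝ :=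
  Real.log (∫ x, Real.exp (h x))

/-- The Gibbs measure `dμ_h = Z_h⁻¹ e^h dx`, where `Z_h = ∫ e^h dx`. -/
def gibbsMeasure {α : Type*} [MeasureSpace α] (h : α → ℝ) : Measure α :=
  (volume : Measure α).tilted h

/-- The mean value of a vector in `ℝ^N`. -/
def meanValue {N : ℕ} (x : Fin N → ℝ) : ℝ :=
  (1 / (N : ℝ)) * ∑ j, x j

/-- `Ξ N i` is the vector `ξ_i(N) ∈ [-R, R]^N`. The sequence `Ξ` is approximating for
`(μ_1, …, μ_n)` if every `ξ_i(N)` has increasing coordinates and `ξ_i(N) → μ_i` in moments. -/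
structure IsApproximatingSequence {R : ℝ} {n : ℕ}
    (Ξ : (N : ℕ) → Fin n → Fin N → SymInterval R)
    (μ : Fin n → ProbabilityMeasure (SymInterval R)) : Prop where
  monotone : ∀ N i, Monotone (Ξ N i)
  tendsto_moment : ∀ (i : Fin n) (k : ℕ),
    Tendsto (fun N => meanValue (fun j => (Ξ N i j : ℝ) ^ k)) atTop
      (𝓝 (∫ x, (x : ℝ) ^ k ∂(μ i : Measure (SymInterval R))))

/-- The action of `S_N` on vectors: `σ(x) = (x_{σ⁻¹(1)}, …, x_{σ⁻¹(N)})`. -/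
def permute {α : Type*} {N : ℕ} (σ : Equiv.Perm (Fin N)) (x : Fin N → α) : Fin N → α :=
  fun j => x (σ⁻¹ j)

/-- For `x_1, …, x_n ∈ [-R, R]^N`, the vector `(h(x_{11}, …, x_{n1}), …, h(x_{1N}, …, x_{nN}))`. -/
def applyCoordwise {R : ℝ} {n N : ℕ} (h : C(Fin n → SymInterval R, ℝ))
    (x : Fin n → Fin N → SymInterval R) : Fin N → ℝ :=
  fun j => h (fun i => x i j)

/-- The mutual pressure `P_sym(h : μ_1, …, μ_n)`, computed along an approximating sequence `Ξ` for
`(μ_1, …, μ_n)`. -/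
def mutualPressure {R : ℝ} {n : ℕ} (h : C(Fin n → SymInterval R, ℝ))
    (Ξ : (N : ℕ) → Fin n → Fin N → SymInterval R) : EReal :=
  limsup (fun N : ℕ => (((1 / (N : ℝ)) * Real.log ((1 / (N.factorial : ℝ) ^ n) *
    ∑ σ : Fin n → Equiv.Perm (Fin N),
      Real.exp (N * meanValue (applyCoordwise h (fun i => permute (σ i) (Ξ N i))))) : ℝ) : EReal))
    atTop

/-- The marginal potential `h_i(x) = log ∫ e^{h(x_1, …, x_{i-1}, x, x_{i+1}, …, x_n)}`, where the
integral is over the variables `x_j` with `j ≠ i`. -/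
def marginalPotential {R : ℝ} {n : ℕ} (h : C(Fin n → SymInterval R, ℝ)) (i : Fin n)
    (x : SymInterval R) : ℝ :=
  Real.log (∫ y : {j : Fin n // j ≠ i} → SymInterval R,
    Real.exp (h (fun j => if hj : j = i then x else y ⟨j, hj⟩)))

end

/-! This is a method-of-types argument. Write Z = ∫ e^h and L = -∑ H(μ_i). The average Ψ over
permutations (`permAverage`) depends on its vectors only through their empirical distributions, and
it does so continuously: close distribution functions on a finite mesh change Ψ by at most a factor
e^{Nε} (`exists_mesh_permAverage_le`). Lebesgue measure on N × n matrices is invariant under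
permuting each column separately, so ∫_C Ψ = ∫_C exp(∑_j h(x_j)) for every set C with the same
invariance (`setIntegral_permAverage`).

Take for C the matrices typical for the μ_i: the average of the log density is near L and the column
distribution functions are near those of the μ_i. On C, Ψ is comparable with its value at the
approximating sequence, so the latter times vol(C) is roughly ∫_C exp(∑_j h(x_j)) ≤ Z^N. By the law
of large numbers for the product of the μ_i, vol(C) is at least about e^{-NL}. This gives the
inequality. If the μ_i are the marginals of the Gibbs measure, samples of that measure also lie in C
with probability tending to 1, so ∫_C exp(∑_j h(x_j)) ≥ Z^N / 2, while vol(C) is at most about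
e^{-NL}. This gives equality.

Conversely, suppose equality holds at h. Adding f(x_i) to h shifts the exponential rate by ∫ f dμ_i,
so the inequality for the perturbed potential yields P(h) + ∫ f dμ_i ≤ P(h + f(x_i))
(`pressure_add_le_pressure`). With t f in place of f, both sides agree at t = 0, and comparing
derivatives there identifies ∫ f dμ_i with the Gibbs expectation of f(x_i). The equivalence of (ii)
and (iii) is Fubini. -/

/-! ### Laws of large numbers on product spaces -/

/-- The strong law of large numbers on the infinite product of a probability measure. -/
theorem ae_tendsto_average {α : Type*} [MeasurableSpace α] (ν : Measure α)
    [IsProbabilityMeasure ν] {f : α → ℝ} (hf : Measurable f) (hfi : Integrable f ν) :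
    ∀ᵐ ω ∂(Measure.infinitePi fun _ : ℕ => ν),
      Tendsto (fun N : ℕ => (1 / (N : ℝ)) * ∑ j : Fin N, f (ω j)) atTop (𝓝 (∫ x, f x ∂ν)) := by
  have hmp := fun i : ℕ => measurePreserving_eval_infinitePi (fun _ : ℕ => ν) i
  have hind : ProbabilityTheory.iIndepFun (fun (i : ℕ) (ω : ℕ → α) => f (ω i))
      (Measure.infinitePi fun _ : ℕ => ν) :=
    ProbabilityTheory.iIndepFun_infinitePi (X := fun _ => f) (fun _ => hf)
  have hmap : ∀ i : ℕ, Measure.map (fun ω : ℕ → α => f (ω i)) (Measure.infinitePi fun _ : ℕ => ν)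
      = ν.map f := fun i => by
    conv_rhs => rw [← (hmp i).map_eq, Measure.map_map hf (hmp i).measurable]
    rfl
  have key := ProbabilityTheory.strong_law_ae_real
    (μ := Measure.infinitePi fun _ : ℕ => ν) (fun (i : ℕ) (ω : ℕ → α) => f (ω i))
    ((hmp 0).integrable_comp_of_integrable hfi)
    (fun i j hij => hind.indepFun hij)
    (fun i => ⟨(hf.comp (measurable_pi_apply i)).aemeasurable,
      (hf.comp (measurable_pi_apply 0)).aemeasurable, by rw [hmap, hmap]⟩)
  have hint : ∫ ω : ℕ → α, f (ω 0) ∂(Measure.infinitePi fun _ : ℕ => ν) = ∫ x, f x ∂ν := by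
    conv_rhs => rw [← (hmp 0).map_eq]
    rw [integral_map (hmp 0).measurable.aemeasurable hf.aestronglyMeasurable]
  filter_upwards [key] with ω hω
  rw [hint] at hω
  refine hω.congr fun N => ?_
  rw [Finset.sum_range, one_div, inv_mul_eq_div]

/-- Transfers almost sure statements on the single space of sequences to the spaces `Fin N → α`,
which vary with N. -/
theorem map_infinitePi_fin {α : Type*} [MeasurableSpace α] (ν : Measure α)
    [IsProbabilityMeasure ν] (N : ℕ) :
    (Measure.infinitePi fun _ : ℕ => ν).map (fun ω (j : Fin N) => ω j)
      = Measure.pi fun _ : Fin N => ν := by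
  have hmeas : Measurable (fun (ω : ℕ → α) (j : Fin N) => ω j) := by fun_prop
  refine (Measure.pi_eq fun s hs => ?_).symm
  rw [Measure.map_apply hmeas (MeasurableSet.univ_pi hs)]
  let t : ℕ → Set α := fun j => if hj : j < N then s ⟨j, hj⟩ else Set.univ
  have ht : ∀ j : Fin N, t j = s j := fun j => by simp [t]
  have hpre : (fun (ω : ℕ → α) (j : Fin N) => ω j) ⁻¹' Set.pi Set.univ s
      = Set.pi (Finset.range N : Set ℕ) t := by
    ext ω
    simp only [Set.mem_preimage, Set.mem_pi, Set.mem_univ, true_imp_iff, Finset.coe_range,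
      Set.mem_Iio]
    exact ⟨fun H j hj => by simpa [t, hj] using H ⟨j, hj⟩,
      fun H j => by simpa [ht] using H j j.2⟩
  rw [hpre, Measure.infinitePi_pi]
  · rw [Finset.prod_range]
    exact Finset.prod_congr rfl fun j _ => by rw [ht]
  · intro j hj
    simpa [t, Finset.mem_range.1 hj] using hs ⟨j, Finset.mem_range.1 hj⟩

/-- The vectors for which the averages of finitely many functions are close to given values. -/
def averageNear {α κ : Type*} (f : κ → α → ℝ) (c : κ → ℝ) (η : ℝ) (N : ℕ) : Set (Fin N → α) :=
  {x | ∀ k, |(1 / (N : ℝ)) * ∑ j, f k (x j) - c k| ≤ η}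

theorem measurableSet_averageNear {α κ : Type*} [MeasurableSpace α] [Finite κ]
    {f : κ → α → ℝ} (hf : ∀ k, Measurable (f k)) (c : κ → ℝ) (η : ℝ) (N : ℕ) :
    MeasurableSet (averageNear f c η N) := by
  have : averageNear f c η N = ⋂ k, {x | |(1 / (N : ℝ)) * ∑ j, f k (x j) - c k| ≤ η} := by
    ext x; simp [averageNear]
  rw [this]
  refine MeasurableSet.iInter fun k => measurableSet_le ?_ measurable_const
  have := hf k
  fun_prop

/-- The weak law of large numbers for finitely many integrable functions. -/
theorem tendsto_measure_averageNear {α κ : Type*} [MeasurableSpace α] [Finite κ]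
    (ν : Measure α) [IsProbabilityMeasure ν] {f : κ → α → ℝ} (hf : ∀ k, Measurable (f k))
    (hfi : ∀ k, Integrable (f k) ν) {η : ℝ} (hη : 0 < η) :
    Tendsto (fun N => (Measure.pi fun _ : Fin N => ν).real
      (averageNear f (fun k => ∫ x, f k x ∂ν) η N)) atTop (𝓝 1) := by
  set P := Measure.infinitePi fun _ : ℕ => ν
  set c : κ → ℝ := fun k => ∫ x, f k x ∂ν
  let S : ℕ → Set (ℕ → α) := fun N => {ω | (fun j : Fin N => ω j) ∈ averageNear f c η N}
  have hmeas : ∀ N, Measurable (fun (ω : ℕ → α) (j : Fin N) => ω j) := fun N => by fun_prop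
  have hS : ∀ N, MeasurableSet (S N) := fun N =>
    hmeas N (measurableSet_averageNear hf c η N)
  have heq : ∀ N, (Measure.pi fun _ : Fin N => ν).real (averageNear f c η N) = P.real (S N) := by
    intro N
    rw [← map_infinitePi_fin ν N, measureReal_def, Measure.map_apply (hmeas N)
      (measurableSet_averageNear hf c η N)]
    rfl
  simp_rw [heq]
  have hae : ∀ᵐ ω ∂P, ∀ᶠ N in atTop, ω ∈ S N := by
    have : ∀ᵐ ω ∂P, ∀ k, Tendsto (fun N : ℕ => (1 / (N : ℝ)) * ∑ j : Fin N, f k (ω j)) atTop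
        (𝓝 (c k)) := ae_all_iff.2 fun k => ae_tendsto_average ν (hf k) (hfi k)
    filter_upwards [this] with ω hω
    have h2 : ∀ᶠ N : ℕ in atTop, ∀ k, |(1 / (N : ℝ)) * ∑ j : Fin N, f k (ω j) - c k| ≤ η := by
      refine eventually_all.2 fun k => ?_
      filter_upwards [Metric.tendsto_nhds.1 (hω k) η hη] with N hN
      exact (Real.dist_eq _ _ ▸ hN).le
    exact h2
  -- Almost every ω lies in `S N` eventually, so the indicators tend to 1 and dominated convergence
  -- applies.
  have hlim : Tendsto (fun N => ∫ ω, (S N).indicator (fun _ => (1 : ℝ)) ω ∂P) atTop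
      (𝓝 (∫ _, (1 : ℝ) ∂P)) := by
    refine tendsto_integral_of_dominated_convergence (fun _ => (1 : ℝ))
      (fun N => (measurable_const.indicator (hS N)).aestronglyMeasurable) (integrable_const _)
      (fun N => ae_of_all _ fun ω => ?_) ?_
    · by_cases h : ω ∈ S N <;> simp [h]
    · filter_upwards [hae] with ω hω
      refine tendsto_const_nhds.congr' ?_
      filter_upwards [hω] with N hN
      simp [hN]
  simpa [integral_indicator_const, hS] using hlim

/-! ### Finite products of measures -/

theorem pi_withDensity_ofReal {ι : Type*} [Fintype ι] {α : ι → Type*}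
    [∀ i, MeasurableSpace (α i)] (m : ∀ i, Measure (α i)) [∀ i, IsFiniteMeasure (m i)]
    {q : ∀ i, α i → ℝ} (hq0 : ∀ i x, 0 ≤ q i x)
    (hqi : ∀ i, Integrable (q i) (m i)) :
    Measure.pi (fun i => (m i).withDensity fun x => ENNReal.ofReal (q i x))
      = (Measure.pi m).withDensity fun x => ENNReal.ofReal (∏ i, q i (x i)) := by
  have hfin : ∀ i, IsFiniteMeasure ((m i).withDensity fun x => ENNReal.ofReal (q i x)) :=
    fun i => isFiniteMeasure_withDensity_ofReal (hqi i).2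
  refine Measure.pi_eq fun s hs => ?_
  have hsu := MeasurableSet.univ_pi hs
  rw [withDensity_apply _ hsu, ← ofReal_integral_eq_lintegral_ofReal
    (Integrable.fintype_prod_dep hqi).integrableOn
    (ae_of_all _ fun x => Finset.prod_nonneg fun i _ => hq0 i _), ← integral_indicator hsu]
  have : (Set.pi Set.univ s).indicator (fun x => ∏ i, q i (x i))
      = fun x => ∏ i, (s i).indicator (q i) (x i) := by
    funext x
    by_cases hx : x ∈ Set.pi Set.univ s
    · rw [Set.indicator_of_mem hx]
      exact Finset.prod_congr rfl fun i _ => by rw [Set.indicator_of_mem (hx i trivial)]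
    · rw [Set.indicator_of_notMem hx]
      simp only [Set.mem_pi, Set.mem_univ, true_imp_iff, not_forall] at hx
      obtain ⟨i, hi⟩ := hx
      exact (Finset.prod_eq_zero (Finset.mem_univ i) (Set.indicator_of_notMem hi _)).symm
  rw [this, integral_fintype_prod_eq_prod (fun i => (s i).indicator (q i)),
    ENNReal.ofReal_prod_of_nonneg
      fun i _ => integral_nonneg fun x => Set.indicator_nonneg (fun y _ => hq0 i y) x]
  refine Finset.prod_congr rfl fun i _ => ?_
  rw [withDensity_apply _ (hs i), integral_indicator (hs i),
    ofReal_integral_eq_lintegral_ofReal (hqi i).integrableOn (ae_of_all _ fun x => hq0 i x)]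

/-- Permuting the rows of a random matrix with independent entries separately in each column
preserves the distribution if the distribution of an entry depends on its column only. -/
theorem measurePreserving_permute_columns {α : Type*} [MeasurableSpace α] {n N : ℕ}
    (m : Fin n → Measure α) [∀ i, IsFiniteMeasure (m i)] (τ : Fin n → Equiv.Perm (Fin N)) :
    MeasurePreserving (fun (x : Fin N → Fin n → α) j i => x (τ i j) i)
      (Measure.pi fun _ => Measure.pi m) (Measure.pi fun _ => Measure.pi m) := by
  have hmeas : Measurable (fun (x : Fin N → Fin n → α) j i => x (τ i j) i) := by fun_prop
  refine ⟨hmeas, Eq.symm ?_⟩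
  -- Rows are tested on boxes only: the map mixes entries of different rows, so the preimage of a
  -- product of general row sets need not be a product.
  refine Measure.pi_eq_generateFrom
    (C := fun _ => Set.pi Set.univ '' Set.pi Set.univ fun _ => {s | MeasurableSet s})
    (fun _ => generateFrom_pi) (fun _ => isPiSystem_pi)
    (fun _ => Measure.FiniteSpanningSetsIn.pi fun i => (m i).toFiniteSpanningSetsIn) ?_
  intro s hs
  choose t ht hts using hs
  obtain rfl : (fun j => Set.pi Set.univ (t j)) = s := funext hts
  have htm : ∀ j i, MeasurableSet (t j i) := fun j i => ht j i trivial
  rw [Measure.map_apply hmeas (MeasurableSet.univ_pi fun j => MeasurableSet.univ_pi (htm j))]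
  have hpre : (fun (x : Fin N → Fin n → α) j i => x (τ i j) i) ⁻¹'
      (Set.pi Set.univ fun j => Set.pi Set.univ (t j))
      = Set.pi Set.univ fun j => Set.pi Set.univ fun i => t ((τ i).symm j) i := by
    ext x
    simp only [Set.mem_preimage, Set.mem_pi, Set.mem_univ, true_imp_iff]
    exact ⟨fun H j i => by simpa using H ((τ i).symm j) i,
      fun H j i => by simpa using H (τ i j) i⟩
  rw [hpre, Measure.pi_pi]
  simp_rw [Measure.pi_pi]
  rw [Finset.prod_comm]
  conv_rhs => rw [Finset.prod_comm]
  exact Finset.prod_congr rfl fun i _ => Equiv.prod_comp (τ i).symm fun j => m i (t j i)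

/-! ### Convergence of averages -/

theorem abs_meanValue_sub_le {N : ℕ} {x y : Fin N → ℝ} {ε : ℝ} (hε : 0 ≤ ε)
    (h : ∀ j, |x j - y j| ≤ ε) : |meanValue x - meanValue y| ≤ ε := by
  rcases Nat.eq_zero_or_pos N with rfl | hN
  · simpa [meanValue] using hε
  · have hN' : (0 : ℝ) < N := by exact_mod_cast hN
    rw [meanValue, meanValue, ← mul_sub, ← Finset.sum_sub_distrib, abs_mul,
      abs_of_nonneg (by positivity), one_div, inv_mul_le_iff₀ hN']
    refine (Finset.abs_sum_le_sum_abs _ _).trans ?_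
    refine (Finset.sum_le_sum fun j _ => h j).trans ?_
    simp

theorem meanValue_mono {N : ℕ} {x y : Fin N → ℝ} (h : ∀ j, x j ≤ y j) :
    meanValue x ≤ meanValue y := by
  unfold meanValue
  gcongr with j
  exact h j

theorem natCast_mul_meanValue {N : ℕ} (x : Fin N → ℝ) : N * meanValue x = ∑ j, x j := by
  rcases Nat.eq_zero_or_pos N with rfl | hN
  · simp
  · have hN' : (N : ℝ) ≠ 0 := by exact_mod_cast hN.ne'
    rw [meanValue]; field_simp

/-- Convergence in moments implies convergence of the averages of continuous functions. -/
theorem tendsto_meanValue_of_tendsto_moment {R : ℝ} {μ : ProbabilityMeasure (SymInterval R)}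
    {ξ : (N : ℕ) → Fin N → SymInterval R}
    (hξ : ∀ k : ℕ, Tendsto (fun N => meanValue (fun j => (ξ N j : ℝ) ^ k)) atTop
      (𝓝 (∫ x, (x : ℝ) ^ k ∂(μ : Measure (SymInterval R)))))
    (φ : C(SymInterval R, ℝ)) :
    Tendsto (fun N => meanValue (fun j => φ (ξ N j))) atTop
      (𝓝 (∫ x, φ x ∂(μ : Measure (SymInterval R)))) := by
  have hint : ∀ ψ : C(SymInterval R, ℝ), Integrable ψ (μ : Measure (SymInterval R)) := fun ψ =>
    ψ.continuous.integrable_of_hasCompactSupport (HasCompactSupport.of_compactSpace _)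
  have hpoly : ∀ p : Polynomial ℝ,
      Tendsto (fun N => meanValue (fun j => p.eval (ξ N j : ℝ))) atTop
        (𝓝 (∫ x, p.eval (x : ℝ) ∂(μ : Measure (SymInterval R)))) := by
    intro p
    have h1 : ∀ N, meanValue (fun j => p.eval (ξ N j : ℝ))
        = ∑ k ∈ Finset.range (p.natDegree + 1),
          p.coeff k * meanValue (fun j => (ξ N j : ℝ) ^ k) := by
      intro N
      simp only [meanValue, Polynomial.eval_eq_sum_range]
      rw [Finset.sum_comm, Finset.mul_sum]
      refine Finset.sum_congr rfl fun k _ => ?_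
      rw [← Finset.mul_sum]; ring
    have h2 : ∫ x, p.eval (x : ℝ) ∂(μ : Measure (SymInterval R))
        = ∑ k ∈ Finset.range (p.natDegree + 1),
          p.coeff k * ∫ x, (x : ℝ) ^ k ∂(μ : Measure (SymInterval R)) := by
      simp only [Polynomial.eval_eq_sum_range]
      rw [integral_finsetSum]
      · simp only [integral_const_mul]
      · intro k _
        exact (hint ⟨fun x => (x : ℝ) ^ k, by fun_prop⟩).const_mul _
    simp_rw [h1, h2]
    exact tendsto_finsetSum _ fun k _ => (hξ k).const_mul _
  refine Metric.tendsto_nhds.2 fun ε hε => ?_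
  -- Weierstrass approximation costs ε/4 in the average and ε/4 in the integral; the polynomial
  -- limit costs another ε/4.
  obtain ⟨p, hp⟩ := exists_polynomial_near_continuousMap (-R) R φ (ε / 4) (by positivity)
  have hp' : ∀ x : SymInterval R, |p.eval (x : ℝ) - φ x| ≤ ε / 4 := fun x => by
    have := (ContinuousMap.norm_coe_le_norm (p.toContinuousMapOn _ - φ) x).trans hp.le
    simpa using this
  have hI : |∫ x, p.eval (x : ℝ) ∂(μ : Measure (SymInterval R))
      - ∫ x, φ x ∂(μ : Measure (SymInterval R))| ≤ ε / 4 := by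
    have hpi : Integrable (fun x : SymInterval R => p.eval (x : ℝ)) (μ : Measure _) :=
      hint (p.toContinuousMapOn _)
    rw [← integral_sub hpi (hint φ), ← Real.norm_eq_abs]
    have := norm_integral_le_of_norm_le_const (μ := (μ : Measure (SymInterval R)))
      (ae_of_all _ fun x => (Real.norm_eq_abs _).trans_le (hp' x))
    simpa using this
  filter_upwards [Metric.tendsto_nhds.1 (hpoly p) (ε / 4) (by positivity)] with N hN
  rw [Real.dist_eq] at hN ⊢
  have h3 := abs_meanValue_sub_le (N := N) (by positivity) (fun j => hp' (ξ N j))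
  rw [abs_le] at h3 hI
  rw [abs_lt] at hN ⊢
  constructor <;> linarith [h3.1, h3.2, hI.1, hI.2, hN.1, hN.2]

/-- The indicator function of `{x | x ≤ t}`. -/
noncomputable def leIndicator {R : ℝ} (t : ℝ) (x : SymInterval R) : ℝ :=
  if (x : ℝ) ≤ t then 1 else 0

theorem measurable_leIndicator {R : ℝ} (t : ℝ) :
    Measurable (leIndicator t : SymInterval R → ℝ) :=
  Measurable.ite (measurableSet_le measurable_subtype_coe measurable_const) measurable_const
    measurable_const

theorem abs_leIndicator_le_one {R : ℝ} (t : ℝ) (x : SymInterval R) : |leIndicator t x| ≤ 1 := by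
  unfold leIndicator; split_ifs <;> simp

/-- The piecewise linear function which is `1` up to `a - δ` and `0` from `a` on. -/
noncomputable def ramp {R : ℝ} (a δ : ℝ) : C(SymInterval R, ℝ) :=
  ⟨fun x => max 0 (min 1 ((a - x) / δ)), by fun_prop⟩

theorem ramp_of_le {R a δ : ℝ} (hδ : 0 < δ) {x : SymInterval R} (h : (x : ℝ) ≤ a - δ) :
    ramp a δ x = 1 := by
  have : 1 ≤ (a - x) / δ := by rw [le_div_iff₀ hδ]; linarith
  simp [ramp, this]

theorem ramp_of_ge {R a δ : ℝ} (hδ : 0 < δ) {x : SymInterval R} (h : a ≤ (x : ℝ)) :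
    ramp a δ x = 0 := by
  have : (a - x) / δ ≤ 0 := div_nonpos_of_nonpos_of_nonneg (by linarith) hδ.le
  simp [ramp, min_eq_right (this.trans zero_le_one), this]

theorem ramp_mem_Icc {R a δ : ℝ} (x : SymInterval R) : ramp a δ x ∈ Set.Icc (0 : ℝ) 1 := by
  simp [ramp]

theorem ramp_le_leIndicator {R t δ : ℝ} (hδ : 0 < δ) (x : SymInterval R) :
    ramp t δ x ≤ leIndicator t x := by
  unfold leIndicator
  split_ifs with h
  · exact (ramp_mem_Icc x).2
  · exact (ramp_of_ge hδ (not_le.1 h).le).le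

theorem leIndicator_le_ramp {R t δ : ℝ} (hδ : 0 < δ) (x : SymInterval R) :
    leIndicator t x ≤ ramp (t + δ) δ x := by
  unfold leIndicator
  split_ifs with h
  · exact (ramp_of_le hδ (by linarith)).ge
  · exact (ramp_mem_Icc x).1

/-- Away from `t` the ramps eventually equal the indicator, and `t` itself is a null set. The two
choices of `a m` give the ramps below and above the indicator. -/
theorem tendsto_integral_ramp {R t : ℝ} {μ : Measure (SymInterval R)} [IsProbabilityMeasure μ]
    (ht : μ {x : SymInterval R | (x : ℝ) = t} = 0) {a : ℕ → ℝ}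
    (ha : ∀ m, a m = t ∨ a m = t + 1 / ((m : ℝ) + 1)) :
    Tendsto (fun m : ℕ => ∫ x, ramp (a m) (1 / ((m : ℝ) + 1)) x ∂μ) atTop
      (𝓝 (∫ x, leIndicator t x ∂μ)) := by
  refine tendsto_integral_of_dominated_convergence (fun _ => (1 : ℝ))
    (fun m => (ContinuousMap.continuous _).aestronglyMeasurable) (integrable_const _)
    (fun m => ae_of_all _ fun x => ?_) ?_
  · rw [Real.norm_eq_abs, abs_of_nonneg (ramp_mem_Icc x).1]
    exact (ramp_mem_Icc x).2
  · have : ∀ᵐ x : SymInterval R ∂μ, (x : ℝ) ≠ t := by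
      rw [ae_iff]; simpa using ht
    filter_upwards [this] with x hx
    refine tendsto_const_nhds.congr' ?_
    have hev : ∀ᶠ m : ℕ in atTop, 1 / ((m : ℝ) + 1) < |(x : ℝ) - t| :=
      (tendsto_order.1 (tendsto_one_div_add_atTop_nhds_zero_nat (𝕜 := ℝ))).2 _
        (abs_pos.2 (sub_ne_zero.2 hx))
    filter_upwards [hev] with m hm
    have hδ : (0 : ℝ) < 1 / ((m : ℝ) + 1) := by positivity
    unfold leIndicator
    split_ifs with h
    · rw [abs_of_nonpos (by linarith)] at hm
      rw [ramp_of_le hδ]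
      rcases ha m with h' | h' <;> rw [h'] <;> linarith
    · rw [abs_of_pos (by linarith)] at hm
      rw [ramp_of_ge hδ]
      rcases ha m with h' | h' <;> rw [h'] <;> linarith

/-- Convergence in moments implies convergence of the distribution functions at every point which
is not an atom of the limit. -/
theorem tendsto_meanValue_leIndicator {R : ℝ} {μ : ProbabilityMeasure (SymInterval R)}
    {ξ : (N : ℕ) → Fin N → SymInterval R}
    (hξ : ∀ k : ℕ, Tendsto (fun N => meanValue (fun j => (ξ N j : ℝ) ^ k)) atTop
      (𝓝 (∫ x, (x : ℝ) ^ k ∂(μ : Measure (SymInterval R)))))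
    {t : ℝ} (ht : (μ : Measure (SymInterval R)) {x : SymInterval R | (x : ℝ) = t} = 0) :
    Tendsto (fun N => meanValue (fun j => leIndicator t (ξ N j))) atTop
      (𝓝 (∫ x, leIndicator t x ∂(μ : Measure (SymInterval R)))) := by
  have hlo := tendsto_integral_ramp ht (a := fun _ => t) (fun _ => Or.inl rfl)
  have hhi := tendsto_integral_ramp ht (a := fun m => t + 1 / ((m : ℝ) + 1)) (fun _ => Or.inr rfl)
  rw [tendsto_order] at hlo hhi ⊢
  constructor
  · intro b hb
    obtain ⟨m, hm⟩ := (hlo.1 b hb).exists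
    have h1 := (tendsto_order.1 (tendsto_meanValue_of_tendsto_moment hξ
      (ramp t (1 / ((m : ℝ) + 1))))).1 b hm
    filter_upwards [h1] with N hN
    exact hN.trans_le (meanValue_mono fun j => ramp_le_leIndicator (by positivity) _)
  · intro b hb
    obtain ⟨m, hm⟩ := (hhi.2 b hb).exists
    have h1 := (tendsto_order.1 (tendsto_meanValue_of_tendsto_moment hξ
      (ramp (t + 1 / ((m : ℝ) + 1)) (1 / ((m : ℝ) + 1))))).2 b hm
    filter_upwards [h1] with N hN
    exact (meanValue_mono fun j => leIndicator_le_ramp (by positivity) _).trans_lt hN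

/-! ### Monotone vectors with close distribution functions -/

/-- For monotone vectors the index sets where the coordinate is at most `t` are initial segments,
hence nested, so all the differences have the same sign. -/
theorem sum_abs_sub_leIndicator {R : ℝ} {N : ℕ} {x y : Fin N → SymInterval R} (hx : Monotone x)
    (hy : Monotone y) (t : ℝ) :
    ∑ j, |leIndicator t (x j) - leIndicator t (y j)|
      = |∑ j, leIndicator t (x j) - ∑ j, leIndicator t (y j)| := by
  have key : ∀ {x y : Fin N → SymInterval R}, (∀ j, (x j : ℝ) ≤ t → (y j : ℝ) ≤ t) →
      ∑ j, |leIndicator t (x j) - leIndicator t (y j)|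
        = |∑ j, leIndicator t (x j) - ∑ j, leIndicator t (y j)| := by
    intro x y h
    have h1 : ∀ j, leIndicator t (x j) - leIndicator t (y j) ≤ 0 := by
      intro j
      unfold leIndicator
      have := h j
      split_ifs <;> simp_all
    rw [← Finset.sum_sub_distrib, abs_of_nonpos (Finset.sum_nonpos fun j _ => h1 j),
      ← Finset.sum_neg_distrib]
    exact Finset.sum_congr rfl fun j _ => abs_of_nonpos (h1 j)
  have hlow : ∀ {x : Fin N → SymInterval R}, Monotone x → IsLowerSet {j | (x j : ℝ) ≤ t} :=
    fun hx a b hba ha => le_trans (Subtype.coe_le_coe.2 (hx hba)) ha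
  rcases (hlow hx).total (hlow hy) with h | h
  · exact key h
  · have := key h
    rw [abs_sub_comm]
    rw [← this]
    exact Finset.sum_congr rfl fun j _ => abs_sub_comm _ _

/-- R - u is the integral over t in [-R, R] of the indicator of u ≤ t, and a left Riemann sum of a
single step misses it by at most one cell. -/
theorem abs_mesh_sum_leIndicator_sub_le {R : ℝ} (hR : 0 < R) {m : ℕ} (hm : 0 < m)
    (u : SymInterval R) :
    |2 * R / m * ∑ k ∈ Finset.range m, leIndicator (-R + k * (2 * R / m)) u - (R - u)|
      ≤ 2 * R / m := by
  have hm' : (0 : ℝ) < m := by exact_mod_cast hm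
  set d : ℝ := 2 * R / m with hd
  have hd0 : 0 < d := by positivity
  have hmd : m * d = 2 * R := by rw [hd]; field_simp
  set s : ℝ := (u + R) / d with hs
  have hsd : s * d = u + R := by rw [hs]; field_simp
  have hs0 : 0 ≤ s := div_nonneg (by linarith [u.2.1]) hd0.le
  have hsm : s ≤ m := by rw [hs, div_le_iff₀ hd0, hmd]; linarith [u.2.2]
  have hcm : ⌈s⌉₊ ≤ m := Nat.ceil_le.2 hsm
  have hcount : ∑ k ∈ Finset.range m, leIndicator (-R + k * d) u = (m : ℝ) - ⌈s⌉₊ := by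
    have h1 : ∀ k : ℕ, leIndicator (-R + k * d) u = if ⌈s⌉₊ ≤ k then (1 : ℝ) else 0 := by
      intro k
      unfold leIndicator
      congr 1
      rw [Nat.ceil_le, hs, div_le_iff₀ hd0]
      exact propext ⟨fun h => by linarith, fun h => by linarith⟩
    simp_rw [h1]
    rw [Finset.sum_boole]
    have h2 : (Finset.range m).filter (fun k => ⌈s⌉₊ ≤ k) = Finset.Ico ⌈s⌉₊ m := by
      ext k; simp [and_comm]
    rw [h2, Nat.card_Ico, Nat.cast_sub hcm]
  rw [hcount]
  have h3 : d * ((m : ℝ) - ⌈s⌉₊) - (R - u) = d * (s - ⌈s⌉₊) := by linear_combination hmd - hsd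
  rw [h3, abs_mul, abs_of_pos hd0]
  have h4 := Nat.le_ceil s
  have h5 := Nat.ceil_lt_add_one hs0
  have h6 : |s - ⌈s⌉₊| ≤ 1 := by rw [abs_le]; constructor <;> linarith
  nlinarith

/-- If the distribution functions of two monotone vectors are close on a mesh then the vectors are
close on average. -/
theorem sum_abs_sub_le_of_monotone {R : ℝ} (hR : 0 < R) {m : ℕ} (hm : 0 < m) {N : ℕ}
    {x y : Fin N → SymInterval R} (hx : Monotone x) (hy : Monotone y) {η : ℝ}
    (h : ∀ k ∈ Finset.range m,
      |∑ j, leIndicator (-R + k * (2 * R / m)) (x j)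
        - ∑ j, leIndicator (-R + k * (2 * R / m)) (y j)| ≤ N * η) :
    ∑ j, |(x j : ℝ) - y j| ≤ N * (4 * R / m + 2 * R * η) := by
  have hm' : (0 : ℝ) < m := by exact_mod_cast hm
  set d : ℝ := 2 * R / m with hd
  have hd0 : 0 < d := by positivity
  have hmd : m * d = 2 * R := by rw [hd]; field_simp
  -- Each of u and v is recovered from its mesh sum up to d; the resulting 2d is the term 4R/m of
  -- the conclusion.
  have h1 : ∀ u v : SymInterval R, |(u : ℝ) - v| ≤ 2 * d + d * ∑ k ∈ Finset.range m,
      |leIndicator (-R + k * d) u - leIndicator (-R + k * d) v| := by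
    intro u v
    have hu := abs_mesh_sum_leIndicator_sub_le hR hm u
    have hv := abs_mesh_sum_leIndicator_sub_le hR hm v
    rw [← hd] at hu hv
    have h2 : |∑ k ∈ Finset.range m, leIndicator (-R + k * d) u
        - ∑ k ∈ Finset.range m, leIndicator (-R + k * d) v|
        ≤ ∑ k ∈ Finset.range m, |leIndicator (-R + k * d) u - leIndicator (-R + k * d) v| := by
      rw [← Finset.sum_sub_distrib]; exact Finset.abs_sum_le_sum_abs _ _
    have h3 := mul_le_mul_of_nonneg_left h2 hd0.le
    rw [← abs_of_pos hd0, ← abs_mul, abs_of_pos hd0, mul_sub] at h3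
    rw [abs_le] at hu hv h3 ⊢
    constructor <;> linarith [hu.1, hu.2, hv.1, hv.2, h3.1, h3.2]
  calc ∑ j, |(x j : ℝ) - y j|
      ≤ ∑ j, (2 * d + d * ∑ k ∈ Finset.range m,
          |leIndicator (-R + k * d) (x j) - leIndicator (-R + k * d) (y j)|) :=
        Finset.sum_le_sum fun j _ => h1 _ _
    _ = N * (2 * d) + d * ∑ k ∈ Finset.range m,
          ∑ j, |leIndicator (-R + k * d) (x j) - leIndicator (-R + k * d) (y j)| := by
        rw [Finset.sum_add_distrib, ← Finset.mul_sum _ _ d, Finset.sum_comm]; simp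
    _ ≤ N * (2 * d) + d * ∑ k ∈ Finset.range m, N * η := by
        gcongr with k hk
        rw [sum_abs_sub_leIndicator hx hy]
        exact h k hk
    _ = N * (4 * R / m + 2 * R * η) := by
        rw [Finset.sum_const, Finset.card_range, nsmul_eq_mul]
        have : 4 * R / m = 2 * d := by rw [hd]; ring
        rw [this, ← hmd]; ring

/-- Uniform continuity handles points at distance less than δ; for the others 2‖h‖ ≤ (2‖h‖/δ) ·
distance. Being linear in the ℓ¹ distance, the bound can be summed over the N coordinates. -/
theorem exists_modulus {R : ℝ} {n : ℕ} (h : C(Fin n → SymInterval R, ℝ)) {ε : ℝ} (hε : 0 < ε) :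
    ∃ K : ℝ, 0 ≤ K ∧ ∀ y z, |h y - h z| ≤ ε + K * ∑ i, |(y i : ℝ) - z i| := by
  obtain ⟨δ, hδ, hh⟩ := Metric.uniformContinuous_iff.1
    (CompactSpace.uniformContinuous_of_continuous h.continuous) ε hε
  refine ⟨2 * ‖h‖ / δ, by positivity, fun y z => ?_⟩
  have hS : 0 ≤ ∑ i, |(y i : ℝ) - z i| := Finset.sum_nonneg fun i _ => abs_nonneg _
  have hdist : dist y z ≤ ∑ i, |(y i : ℝ) - z i| := by
    refine (dist_pi_le_iff hS).2 fun i => ?_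
    rw [Subtype.dist_eq, Real.dist_eq]
    exact Finset.single_le_sum (f := fun i => |(y i : ℝ) - z i|) (fun i _ => abs_nonneg _)
      (Finset.mem_univ i)
  by_cases hyz : dist y z < δ
  · have := (hh hyz).le
    rw [Real.dist_eq] at this
    have h0 : 0 ≤ 2 * ‖h‖ / δ * ∑ i, |(y i : ℝ) - z i| := by positivity
    linarith
  · have h1 : |h y - h z| ≤ 2 * ‖h‖ := by
      have hy := h.norm_coe_le_norm y
      have hz := h.norm_coe_le_norm z
      rw [Real.norm_eq_abs] at hy hz
      linarith [abs_sub (h y) (h z)]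
    have h2 : 2 * ‖h‖ ≤ 2 * ‖h‖ / δ * ∑ i, |(y i : ℝ) - z i| := by
      rw [div_mul_eq_mul_div, le_div_iff₀ hδ]
      gcongr
      exact (not_lt.1 hyz).trans hdist
    linarith

/-- The average over all permutations which defines the mutual pressure. -/
noncomputable def permAverage {R : ℝ} {n N : ℕ} (h : C(Fin n → SymInterval R, ℝ))
    (x : Fin n → Fin N → SymInterval R) : ℝ :=
  (1 / (N.factorial : ℝ) ^ n) * ∑ σ : Fin n → Equiv.Perm (Fin N),
    Real.exp (N * meanValue (applyCoordwise h (fun i => permute (σ i) (x i))))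

theorem permAverage_pos {R : ℝ} {n N : ℕ} (h : C(Fin n → SymInterval R, ℝ))
    (x : Fin n → Fin N → SymInterval R) : 0 < permAverage h x := by
  have := N.factorial_pos
  exact mul_pos (by positivity) (Finset.sum_pos (fun σ _ => Real.exp_pos _) Finset.univ_nonempty)

/-- Right multiplication by τ reindexes the sum. It allows vectors to be sorted before they are
compared. -/
theorem permAverage_permute {R : ℝ} {n N : ℕ} (h : C(Fin n → SymInterval R, ℝ))
    (x : Fin n → Fin N → SymInterval R) (τ : Fin n → Equiv.Perm (Fin N)) :
    permAverage h (fun i => permute (τ i) (x i)) = permAverage h x := by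
  unfold permAverage
  congr 1
  refine Fintype.sum_equiv (Equiv.mulRight τ) _ _ fun σ => ?_
  congr 2

theorem permAverage_le_exp_mul {R : ℝ} {n N : ℕ} {h g : C(Fin n → SymInterval R, ℝ)}
    {x y : Fin n → Fin N → SymInterval R} {c : ℝ}
    (H : ∀ σ : Fin n → Equiv.Perm (Fin N), ∑ j, h (fun i => x i (σ i j))
      ≤ c + ∑ j, g (fun i => y i (σ i j))) :
    permAverage h x ≤ Real.exp c * permAverage g y := by
  unfold permAverage
  rw [mul_left_comm, Finset.mul_sum _ _ (Real.exp c)]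
  gcongr with σ
  rw [← Real.exp_add, natCast_mul_meanValue, natCast_mul_meanValue]
  exact Real.exp_le_exp.2 (H fun i => (σ i)⁻¹)

/-- The permutation average depends continuously on the distribution functions of the vectors. -/
theorem exists_mesh_permAverage_le {R : ℝ} (hR : 0 < R) {n : ℕ} (h : C(Fin n → SymInterval R, ℝ))
    {ε : ℝ} (hε : 0 < ε) :
    ∃ (T : Finset ℝ) (η : ℝ), 0 < η ∧ ∀ (N : ℕ) (x y : Fin n → Fin N → SymInterval R),
      (∀ i, ∀ t ∈ T, |∑ j, leIndicator t (x i j) - ∑ j, leIndicator t (y i j)| ≤ N * η) →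
      permAverage h x ≤ Real.exp (N * ε) * permAverage h y := by
  obtain ⟨K, hK, hmod⟩ := exists_modulus h (half_pos hε)
  have hn : (0 : ℝ) < K * n + 1 := by positivity
  -- The mesh term 4R/m and the term 2Rη are each at most ε/(4(Kn+1)). The n columns, weighted by K,
  -- then cost at most Nε/2, and the modulus costs the other Nε/2. The +1 keeps the denominator
  -- positive when Kn = 0.
  obtain ⟨m, hm⟩ := exists_nat_gt (max 0 (4 * R / (ε / (4 * (K * n + 1)))))
  have hm0 : (0 : ℝ) < m := (le_max_left _ _).trans_lt hm
  have hm0' : 0 < m := by exact_mod_cast hm0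
  have hmR : 4 * R / m ≤ ε / (4 * (K * n + 1)) := by
    have := (le_max_right _ _).trans_lt hm
    rw [div_lt_iff₀ (by positivity)] at this
    rw [div_le_iff₀ hm0]
    linarith
  set η : ℝ := ε / (4 * (K * n + 1)) / (2 * R) with hη
  refine ⟨(Finset.range m).image fun k : ℕ => -R + k * (2 * R / m), η, by positivity, ?_⟩
  have key : ∀ (N : ℕ) (x y : Fin n → Fin N → SymInterval R), (∀ i, Monotone (x i)) →
      (∀ i, Monotone (y i)) →
      (∀ i, ∀ k ∈ Finset.range m, |∑ j, leIndicator (-R + k * (2 * R / m)) (x i j)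
        - ∑ j, leIndicator (-R + k * (2 * R / m)) (y i j)| ≤ N * η) →
      permAverage h x ≤ Real.exp (N * ε) * permAverage h y := by
    intro N x y hx hy hxy
    refine permAverage_le_exp_mul fun σ => ?_
    have h1 : ∀ i, ∑ j, |(x i (σ i j) : ℝ) - y i (σ i j)| ≤ N * (ε / (2 * (K * n + 1))) := by
      intro i
      rw [Equiv.sum_comp (σ i) fun j => |(x i j : ℝ) - y i j|]
      refine (sum_abs_sub_le_of_monotone hR hm0' (hx i) (hy i) (hxy i)).trans ?_
      have : 2 * R * η = ε / (4 * (K * n + 1)) := by rw [hη]; field_simp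
      rw [this]
      gcongr
      have : ε / (2 * (K * n + 1)) = ε / (4 * (K * n + 1)) + ε / (4 * (K * n + 1)) := by
        field_simp; ring
      linarith
    have h2 : ∀ j, h (fun i => x i (σ i j)) ≤ (ε / 2 + K * ∑ i, |(x i (σ i j) : ℝ) - y i (σ i j)|)
        + h (fun i => y i (σ i j)) := fun j => by
      linarith [(abs_le.1 (hmod (fun i => x i (σ i j)) (fun i => y i (σ i j)))).2]
    calc ∑ j, h (fun i => x i (σ i j))
        ≤ ∑ j, ((ε / 2 + K * ∑ i, |(x i (σ i j) : ℝ) - y i (σ i j)|)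
            + h (fun i => y i (σ i j))) := Finset.sum_le_sum fun j _ => h2 j
      _ = N * (ε / 2) + K * ∑ i, ∑ j, |(x i (σ i j) : ℝ) - y i (σ i j)|
            + ∑ j, h (fun i => y i (σ i j)) := by
          rw [Finset.sum_add_distrib, Finset.sum_add_distrib, ← Finset.mul_sum, Finset.sum_comm]
          simp
      _ ≤ N * (ε / 2) + K * ∑ _i : Fin n, N * (ε / (2 * (K * n + 1)))
            + ∑ j, h (fun i => y i (σ i j)) := by
          gcongr with i
          exact h1 i
      _ ≤ N * ε + ∑ j, h (fun i => y i (σ i j)) := by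
          rw [Finset.sum_const, Finset.card_univ, Fintype.card_fin, nsmul_eq_mul]
          have : K * n * (ε / (2 * (K * n + 1))) ≤ ε / 2 := by
            rw [mul_div_assoc', div_le_div_iff₀ (by positivity) (by positivity)]
            nlinarith
          have := mul_le_mul_of_nonneg_left this (Nat.cast_nonneg (α := ℝ) N)
          linarith
  intro N x y hxy
  -- Sorting changes neither the permutation averages nor the distribution functions, which reduces
  -- the claim to monotone vectors.
  have hsort : ∀ z : Fin n → Fin N → SymInterval R,
      (∀ i, Monotone (permute (Tuple.sort (z i))⁻¹ (z i))) := by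
    intro z i
    have := Tuple.monotone_sort (z i)
    exact fun a b hab => this hab
  have hperm : ∀ (σ : Equiv.Perm (Fin N)) (z : Fin N → SymInterval R) (t : ℝ),
      ∑ j, leIndicator t (permute σ z j) = ∑ j, leIndicator t (z j) := fun σ z t =>
    Equiv.sum_comp σ⁻¹ fun j => leIndicator t (z j)
  rw [← permAverage_permute h x fun i => (Tuple.sort (x i))⁻¹,
    ← permAverage_permute h y fun i => (Tuple.sort (y i))⁻¹]
  refine key N _ _ (hsort x) (hsort y) fun i k hk => ?_
  rw [hperm, hperm]
  exact hxy i _ (Finset.mem_image_of_mem _ hk)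

/-! ### Lebesgue measure on the cube -/

theorem volume_symInterval_apply {R : ℝ} (s : Set (SymInterval R)) :
    (volume : Measure (SymInterval R)) s = (volume : Measure ℝ) (Subtype.val '' s) :=
  comap_subtype_coe_apply measurableSet_Icc volume s

theorem volume_symInterval_univ {R : ℝ} :
    (volume : Measure (SymInterval R)) Set.univ = ENNReal.ofReal (R - -R) := by
  rw [volume_symInterval_apply, Set.image_univ, Subtype.range_coe, Real.volume_Icc]

instance isFiniteMeasure_volume_symInterval {R : ℝ} :
    IsFiniteMeasure (volume : Measure (SymInterval R)) :=
  ⟨by rw [volume_symInterval_univ]; exact ENNReal.ofReal_lt_top⟩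

theorem volume_symInterval_coe_eq {R : ℝ} (t : ℝ) :
    (volume : Measure (SymInterval R)) {x : SymInterval R | (x : ℝ) = t} = 0 := by
  rw [volume_symInterval_apply]
  refine measure_mono_null (t := {t}) ?_ Real.volume_singleton
  rintro _ ⟨x, hx, rfl⟩
  exact hx

theorem neZero_volume_cube {R : ℝ} (hR : 0 < R) (ι : Type*) [Fintype ι] :
    NeZero (volume : Measure (ι → SymInterval R)) := by
  refine ⟨fun h0 => ?_⟩
  have h1 : (volume : Measure (ι → SymInterval R)) Set.univ = 0 := by rw [h0]; simp
  rw [volume_pi, Measure.pi_univ, Finset.prod_eq_zero_iff] at h1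
  obtain ⟨i, -, hi⟩ := h1
  rw [volume_symInterval_univ, ENNReal.ofReal_eq_zero] at hi
  linarith

theorem integrable_of_continuous {α : Type*} [TopologicalSpace α] [CompactSpace α]
    [MeasurableSpace α] [OpensMeasurableSpace α] {m : Measure α} [IsFiniteMeasure m]
    {f : α → ℝ} (hf : Continuous f) : Integrable f m :=
  hf.integrable_of_hasCompactSupport (HasCompactSupport.of_compactSpace _)

theorem integral_exp_cube_pos {R : ℝ} (hR : 0 < R) {ι : Type*} [Fintype ι]
    {h : (ι → SymInterval R) → ℝ} (hh : Continuous h) : 0 < ∫ x, Real.exp (h x) := by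
  have := neZero_volume_cube hR ι
  exact integral_exp_pos (integrable_of_continuous (Real.continuous_exp.comp hh))

theorem withDensity_ofReal_real {α : Type*} [MeasurableSpace α] {m : Measure α} {g : α → ℝ}
    (hg0 : ∀ x, 0 ≤ g x) (hgi : Integrable g m) {s : Set α} (hs : MeasurableSet s) :
    (m.withDensity fun x => ENNReal.ofReal (g x)).real s = ∫ x in s, g x ∂m := by
  rw [measureReal_def, withDensity_apply _ hs, ← ofReal_integral_eq_lintegral_ofReal
    hgi.integrableOn (ae_of_all _ hg0), ENNReal.toReal_ofReal (integral_nonneg hg0)]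

/-! ### Integrals of permutation averages -/

/-- Column permutations preserve both Lebesgue measure and `C`, so all (N!)^n terms have the same
integral over `C` and the normalisation cancels their number. -/
theorem setIntegral_permAverage {R : ℝ} {n N : ℕ} (h : C(Fin n → SymInterval R, ℝ))
    {C : Set (Fin N → Fin n → SymInterval R)} (hC : MeasurableSet C)
    (hinv : ∀ (τ : Fin n → Equiv.Perm (Fin N)) x, (fun j i => x (τ i j) i) ∈ C ↔ x ∈ C) :
    ∫ x in C, permAverage h (fun i j => x j i) = ∫ x in C, Real.exp (∑ j, h (x j)) := by
  have hcont : Continuous fun x : Fin N → Fin n → SymInterval R => Real.exp (∑ j, h (x j)) := by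
    fun_prop
  have hcontσ : ∀ σ : Fin n → Equiv.Perm (Fin N),
      Continuous fun x : Fin N → Fin n → SymInterval R =>
        Real.exp (∑ j, h (fun i => x (σ i j) i)) := fun σ => by fun_prop
  have hterm : ∀ σ : Fin n → Equiv.Perm (Fin N),
      ∫ x in C, Real.exp (∑ j, h (fun i => x (σ i j) i))
        = ∫ x in C, Real.exp (∑ j, h (x j)) := by
    intro σ
    have hmp := measurePreserving_permute_columns
      (fun _ : Fin n => (volume : Measure (SymInterval R))) σ
    rw [← integral_indicator hC, ← integral_indicator hC]
    have h1 := integral_map (μ := (volume : Measure (Fin N → Fin n → SymInterval R)))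
      hmp.measurable.aemeasurable (f := C.indicator fun x => Real.exp (∑ j, h (x j)))
      ((hcont.measurable.indicator hC).aestronglyMeasurable)
    rw [show Measure.map _ (volume : Measure (Fin N → Fin n → SymInterval R)) = volume from
      hmp.map_eq] at h1
    refine Eq.trans (integral_congr_ae (ae_of_all _ fun x => ?_)) h1.symm
    by_cases hx : x ∈ C
    · simp only [Set.indicator_of_mem hx, Set.indicator_of_mem ((hinv σ x).2 hx)]
    · simp only [Set.indicator_of_notMem hx, Set.indicator_of_notMem (mt (hinv σ x).1 hx)]
  unfold permAverage
  rw [integral_const_mul, integral_finsetSum]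
  · have h2 : ∀ σ : Fin n → Equiv.Perm (Fin N), ∫ x in C, Real.exp (N * meanValue
        (applyCoordwise h fun i => permute (σ i) fun j => x j i))
        = ∫ x in C, Real.exp (∑ j, h (x j)) := by
      intro σ
      simp_rw [natCast_mul_meanValue]
      exact hterm fun i => (σ i)⁻¹
    simp_rw [h2]
    rw [Finset.sum_const, Finset.card_univ, nsmul_eq_mul, Fintype.card_fun, Fintype.card_perm,
      Fintype.card_fin, Fintype.card_fin]
    have := N.factorial_pos
    push_cast
    field_simp
  · intro σ _
    simp_rw [natCast_mul_meanValue]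
    exact (integrable_of_continuous (hcontσ fun i => (σ i)⁻¹)).integrableOn

theorem integrable_permAverage {R : ℝ} {n N : ℕ} (h : C(Fin n → SymInterval R, ℝ)) :
    Integrable fun x : Fin N → Fin n → SymInterval R => permAverage h (fun i j => x j i) := by
  unfold permAverage
  simp_rw [natCast_mul_meanValue]
  refine integrable_of_continuous ?_
  unfold applyCoordwise permute
  fun_prop

/-! ### Densities -/

/-- `p` is a density of `μ` with respect to Lebesgue measure for which `p log p` is integrable. -/
structure HasEntropyDensity {R : ℝ} (μ : Measure (SymInterval R)) (p : SymInterval R → ℝ) :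
    Prop where
  measurable : Measurable p
  nonneg : ∀ x, 0 ≤ p x
  eq_withDensity : μ = volume.withDensity fun x => ENNReal.ofReal (p x)
  integrable_mul_log : Integrable fun x => p x * Real.log (p x)

namespace HasEntropyDensity

variable {R : ℝ} {μ : Measure (SymInterval R)} {p : SymInterval R → ℝ}

theorem integrable [IsFiniteMeasure μ] (hp : HasEntropyDensity μ p) : Integrable p := by
  refine ⟨hp.measurable.aestronglyMeasurable, ?_⟩
  rw [hasFiniteIntegral_iff_ofReal (ae_of_all _ hp.nonneg)]
  have h1 : μ Set.univ < ⊤ := measure_lt_top _ _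
  rwa [hp.eq_withDensity, withDensity_apply _ MeasurableSet.univ, Measure.restrict_univ] at h1

theorem integrable_log (hp : HasEntropyDensity μ p) : Integrable (fun x => Real.log (p x)) μ := by
  rw [hp.eq_withDensity, integrable_withDensity_iff_integrable_smul' hp.measurable.ennreal_ofReal
    (ae_of_all _ fun _ => ENNReal.ofReal_lt_top)]
  simpa [ENNReal.toReal_ofReal, hp.nonneg] using hp.integrable_mul_log

theorem integral_log (hp : HasEntropyDensity μ p) :
    ∫ x, Real.log (p x) ∂μ = ∫ x, p x * Real.log (p x) := by
  rw [hp.eq_withDensity, integral_withDensity_eq_integral_toReal_smul hp.measurable.ennreal_ofReal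
    (ae_of_all _ fun _ => ENNReal.ofReal_lt_top)]
  simp [ENNReal.toReal_ofReal, hp.nonneg]

/-- A density excludes atoms, so the distribution functions converge at every mesh point. -/
theorem measure_coe_eq (hp : HasEntropyDensity μ p) (t : ℝ) :
    μ {x : SymInterval R | (x : ℝ) = t} = 0 := by
  rw [hp.eq_withDensity]
  exact withDensity_absolutelyContinuous _ _ (volume_symInterval_coe_eq t)

end HasEntropyDensity

theorem entropy_eq_of_hasEntropyDensity {R : ℝ} {μ : ProbabilityMeasure (SymInterval R)}
    {p : SymInterval R → ℝ} (hp : HasEntropyDensity (μ : Measure (SymInterval R)) p) :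
    entropy μ = ((-∫ x, p x * Real.log (p x) : ℝ) : EReal) := by
  have hac : (μ : Measure (SymInterval R)) ≪ volume := by
    rw [hp.eq_withDensity]; exact withDensity_absolutelyContinuous _ _
  have hae : (fun x => ((μ : Measure (SymInterval R)).rnDeriv volume x).toReal) =ᵐ[volume] p := by
    have h1 := Measure.rnDeriv_withDensity (volume : Measure (SymInterval R))
      hp.measurable.ennreal_ofReal
    rw [← hp.eq_withDensity] at h1
    filter_upwards [h1] with x hx
    rw [hx, ENNReal.toReal_ofReal (hp.nonneg x)]
  have hae2 : (fun x => ((μ : Measure (SymInterval R)).rnDeriv volume x).toReal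
      * Real.log ((μ : Measure (SymInterval R)).rnDeriv volume x).toReal)
      =ᵐ[volume] fun x => p x * Real.log (p x) := by
    filter_upwards [hae] with x hx
    rw [hx]
  unfold entropy
  simp only
  rw [if_pos ⟨hac, hp.integrable_mul_log.congr hae2.symm⟩, integral_congr_ae hae2]

theorem exists_hasEntropyDensity {R : ℝ} {μ : ProbabilityMeasure (SymInterval R)}
    (hμ : entropy μ ≠ ⊥) :
    ∃ p, HasEntropyDensity (μ : Measure (SymInterval R)) p := by
  unfold entropy at hμ
  simp only [ne_eq, ite_eq_right_iff, not_forall] at hμ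
  obtain ⟨⟨hac, hint⟩, -⟩ := hμ
  refine ⟨_, (Measure.measurable_rnDeriv _ _).ennreal_toReal, fun x => ENNReal.toReal_nonneg, ?_,
    hint⟩
  conv_lhs => rw [← Measure.withDensity_rnDeriv_eq _ _ hac]
  refine withDensity_congr_ae ?_
  filter_upwards [Measure.rnDeriv_lt_top (μ : Measure (SymInterval R)) volume] with x hx
  rw [ENNReal.ofReal_toReal hx.ne]

/-! ### Typical vectors -/

section Typical

variable {R : ℝ} {n : ℕ}

/-- The functions whose averages determine the typical vectors: the logarithm of the product of
the densities, and the indicator functions of half-lines. -/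
noncomputable def testFunction (p : Fin n → SymInterval R → ℝ) (T : Finset ℝ) :
    Option (Fin n × T) → (Fin n → SymInterval R) → ℝ
  | none, y => ∑ i, Real.log (p i (y i))
  | some (i, t), y => leIndicator t (y i)

/-- The expectations of the test functions. -/
noncomputable def testMean (μ : Fin n → ProbabilityMeasure (SymInterval R))
    (p : Fin n → SymInterval R → ℝ) (T : Finset ℝ) : Option (Fin n × T) → ℝ
  | none => ∑ i, ∫ x, p i x * Real.log (p i x)
  | some (i, t) => ∫ x, leIndicator t x ∂(μ i : Measure (SymInterval R))

/-- The typical vectors. -/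
def typicalSet (μ : Fin n → ProbabilityMeasure (SymInterval R))
    (p : Fin n → SymInterval R → ℝ) (T : Finset ℝ) (η : ℝ) (N : ℕ) :
    Set (Fin N → Fin n → SymInterval R) :=
  averageNear (testFunction p T) (testMean μ p T) η N

variable {μ : Fin n → ProbabilityMeasure (SymInterval R)} {p : Fin n → SymInterval R → ℝ}

theorem measurable_testFunction (hp : ∀ i, HasEntropyDensity (μ i : Measure (SymInterval R)) (p i))
    (T : Finset ℝ) (k : Option (Fin n × T)) : Measurable (testFunction p T k) := by
  rcases k with _ | ⟨i, t⟩
  · exact Finset.measurable_sum _ fun i _ =>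
      Real.measurable_log.comp ((hp i).measurable.comp (measurable_pi_apply i))
  · exact (measurable_leIndicator _).comp (measurable_pi_apply i)

theorem measurableSet_typicalSet
    (hp : ∀ i, HasEntropyDensity (μ i : Measure (SymInterval R)) (p i)) (T : Finset ℝ) (η : ℝ)
    (N : ℕ) : MeasurableSet (typicalSet μ p T η N) :=
  measurableSet_averageNear (measurable_testFunction hp T) _ _ _

/-- Every test function is a sum of functions of single coordinates, so its average does not see how
the entries of different columns are paired. -/
theorem mem_typicalSet_permute (T : Finset ℝ) (η : ℝ) (N : ℕ) (τ : Fin n → Equiv.Perm (Fin N))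
    (x : Fin N → Fin n → SymInterval R) :
    (fun j i => x (τ i j) i) ∈ typicalSet μ p T η N ↔ x ∈ typicalSet μ p T η N := by
  refine forall_congr' fun k => ?_
  suffices h : ∑ j, testFunction p T k (fun i => x (τ i j) i) = ∑ j, testFunction p T k (x j) by
    rw [h]
  rcases k with _ | ⟨i, t⟩
  · simp only [testFunction]
    rw [Finset.sum_comm, Finset.sum_comm (f := fun j i => Real.log (p i (x j i)))]
    exact Finset.sum_congr rfl fun i _ => Equiv.sum_comp (τ i) fun j => Real.log (p i (x j i))
  · exact Equiv.sum_comp (τ i) fun j => leIndicator t (x j i)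

/-- Vectors of independent samples of a measure with marginals `μ i` are typical with probability
tending to `1`. -/
theorem tendsto_measure_typicalSet
    (hp : ∀ i, HasEntropyDensity (μ i : Measure (SymInterval R)) (p i))
    (ν : Measure (Fin n → SymInterval R)) [IsProbabilityMeasure ν]
    (hν : ∀ i, (μ i : Measure (SymInterval R)) = ν.map (fun x => x i)) (T : Finset ℝ) {η : ℝ}
    (hη : 0 < η) :
    Tendsto (fun N => (Measure.pi fun _ : Fin N => ν).real (typicalSet μ p T η N)) atTop
      (𝓝 1) := by
  have hmp : ∀ i, MeasurePreserving (fun x : Fin n → SymInterval R => x i) ν (μ i) := fun i =>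
    ⟨measurable_pi_apply i, (hν i).symm⟩
  have hint : ∀ (i : Fin n) {g : SymInterval R → ℝ}, Measurable g →
      ∫ y, g (y i) ∂ν = ∫ x, g x ∂(μ i : Measure (SymInterval R)) := fun i g hg => by
    rw [hν i, integral_map (measurable_pi_apply i).aemeasurable hg.aestronglyMeasurable]
  have hlog : ∀ i, Integrable (fun y : Fin n → SymInterval R => Real.log (p i (y i))) ν :=
    fun i => (hmp i).integrable_comp_of_integrable (hp i).integrable_log
  have hfi : ∀ k, Integrable (testFunction p T k) ν := by
    rintro (_ | ⟨i, t⟩)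
    · exact integrable_finsetSum _ fun i _ => hlog i
    · exact Integrable.of_bound ((measurable_leIndicator _).comp
        (measurable_pi_apply i)).aestronglyMeasurable 1
        (ae_of_all _ fun y => abs_leIndicator_le_one _ _)
  have hmean : (fun k => ∫ y, testFunction p T k y ∂ν) = testMean μ p T := by
    funext k
    rcases k with _ | ⟨i, t⟩
    · simp only [testFunction, testMean]
      rw [integral_finsetSum _ fun i _ => hlog i]
      refine Finset.sum_congr rfl fun i _ => ?_
      exact (hint i (Real.measurable_log.comp (hp i).measurable)).trans (hp i).integral_log
    · exact hint i (measurable_leIndicator _)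
  have := tendsto_measure_averageNear ν (measurable_testFunction hp T) hfi hη
  rwa [hmean] at this

theorem eventually_half_le_measure_typicalSet
    (hp : ∀ i, HasEntropyDensity (μ i : Measure (SymInterval R)) (p i))
    (ν : Measure (Fin n → SymInterval R)) [IsProbabilityMeasure ν]
    (hν : ∀ i, (μ i : Measure (SymInterval R)) = ν.map (fun x => x i)) (T : Finset ℝ) {η : ℝ}
    (hη : 0 < η) :
    ∀ᶠ N in atTop, 1 / 2 ≤ (Measure.pi fun _ : Fin N => ν).real (typicalSet μ p T η N) :=
  (tendsto_measure_typicalSet hp ν hν T hη).eventually (eventually_ge_nhds (by norm_num))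

theorem abs_sum_log_sub_le {T : Finset ℝ} {η : ℝ} {N : ℕ} {x : Fin N → Fin n → SymInterval R}
    (hx : x ∈ typicalSet μ p T η N) :
    |∑ j, ∑ i, Real.log (p i (x j i)) - N * ∑ i, ∫ x, p i x * Real.log (p i x)| ≤ N * η := by
  have h1 := hx none
  rcases Nat.eq_zero_or_pos N with rfl | hN
  · simp
  · have hN' : (0 : ℝ) < N := by exact_mod_cast hN
    have h2 := mul_le_mul_of_nonneg_left h1 hN'.le
    rw [← abs_of_pos hN', ← abs_mul, abs_of_pos hN'] at h2
    refine le_of_eq_of_le ?_ h2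
    congr 1
    simp only [testFunction, testMean]
    field_simp

theorem pi_pi_eq_withDensity
    (hp : ∀ i, HasEntropyDensity (μ i : Measure (SymInterval R)) (p i)) (N : ℕ) :
    (Measure.pi fun _ : Fin N => Measure.pi fun i => (μ i : Measure (SymInterval R)))
      = (volume : Measure (Fin N → Fin n → SymInterval R)).withDensity
        fun x => ENNReal.ofReal (∏ j, ∏ i, p i (x j i)) := by
  have h1 : (Measure.pi fun i => (μ i : Measure (SymInterval R)))
      = (volume : Measure (Fin n → SymInterval R)).withDensity
        fun y => ENNReal.ofReal (∏ i, p i (y i)) := by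
    rw [volume_pi, ← pi_withDensity_ofReal _ (fun i => (hp i).nonneg) fun i => (hp i).integrable]
    congr 1
    funext i
    exact (hp i).eq_withDensity
  rw [h1, pi_withDensity_ofReal (ι := Fin N) (fun _ => (volume : Measure (Fin n → SymInterval R)))
    (q := fun _ y => ∏ i, p i (y i)) (fun _ y => Finset.prod_nonneg fun i _ => (hp i).nonneg _)
    fun _ => Integrable.fintype_prod_dep fun i => (hp i).integrable]
  rfl

theorem integrable_prod_prod
    (hp : ∀ i, HasEntropyDensity (μ i : Measure (SymInterval R)) (p i)) (N : ℕ) :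
    Integrable fun x : Fin N → Fin n → SymInterval R => ∏ j, ∏ i, p i (x j i) :=
  Integrable.fintype_prod (ι := Fin N) (μ := fun _ => (volume : Measure (Fin n → SymInterval R)))
    (f := fun _ (y : Fin n → SymInterval R) => ∏ i, p i (y i)) fun _ =>
      Integrable.fintype_prod (f := p) fun i => (hp i).integrable

/-- On typical vectors the product density is at most e^{N(L+η)}; this bounds the volume from below
once the typical set has substantial mass. Zeros of `p i` are harmless, since `Real.log 0 = 0` still
gives p ≤ exp (log p). -/
theorem measure_typicalSet_le
    (hp : ∀ i, HasEntropyDensity (μ i : Measure (SymInterval R)) (p i)) (T : Finset ℝ) (η : ℝ)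
    (N : ℕ) :
    (Measure.pi fun _ : Fin N => Measure.pi fun i => (μ i : Measure (SymInterval R))).real
        (typicalSet μ p T η N)
      ≤ Real.exp (N * ((∑ i, ∫ x, p i x * Real.log (p i x)) + η))
        * (volume : Measure (Fin N → Fin n → SymInterval R)).real (typicalSet μ p T η N) := by
  have hC := measurableSet_typicalSet hp T η N
  rw [pi_pi_eq_withDensity hp, withDensity_ofReal_real (fun x => Finset.prod_nonneg fun j _ =>
    Finset.prod_nonneg fun i _ => (hp i).nonneg _) (integrable_prod_prod hp N) hC,
    mul_comm, ← smul_eq_mul, ← setIntegral_const]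
  refine setIntegral_mono_on (integrable_prod_prod hp N).integrableOn (integrable_const _) hC
    fun x hx => ?_
  calc ∏ j, ∏ i, p i (x j i) ≤ ∏ j, ∏ i, Real.exp (Real.log (p i (x j i))) :=
        Finset.prod_le_prod (fun j _ => Finset.prod_nonneg fun i _ => (hp i).nonneg _)
          fun j _ => Finset.prod_le_prod (fun i _ => (hp i).nonneg _)
            fun i _ => Real.le_exp_log _
    _ = Real.exp (∑ j, ∑ i, Real.log (p i (x j i))) := by simp_rw [Real.exp_sum]
    _ ≤ _ := Real.exp_le_exp.2 (by linarith [(abs_le.1 (abs_sum_log_sub_le hx)).2])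

/-- On typical vectors the product density is at least e^{N(L-η)}, while the total mass is 1.
Positivity is needed because exp (log p) = p fails at zeros of p. -/
theorem volume_typicalSet_le
    (hp : ∀ i, HasEntropyDensity (μ i : Measure (SymInterval R)) (p i))
    (hpos : ∀ i x, 0 < p i x) (T : Finset ℝ) (η : ℝ) (N : ℕ) :
    Real.exp (N * ((∑ i, ∫ x, p i x * Real.log (p i x)) - η))
      * (volume : Measure (Fin N → Fin n → SymInterval R)).real (typicalSet μ p T η N) ≤ 1 := by
  have hC := measurableSet_typicalSet hp T η N
  have h1 : (Measure.pi fun _ : Fin N => Measure.pi fun i => (μ i : Measure (SymInterval R))).real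
      (typicalSet μ p T η N) ≤ 1 := measureReal_le_one
  refine le_trans ?_ h1
  rw [pi_pi_eq_withDensity hp, withDensity_ofReal_real (fun x => Finset.prod_nonneg fun j _ =>
    Finset.prod_nonneg fun i _ => (hp i).nonneg _) (integrable_prod_prod hp N) hC,
    mul_comm, ← smul_eq_mul, ← setIntegral_const]
  refine setIntegral_mono_on (integrable_const _) (integrable_prod_prod hp N).integrableOn hC
    fun x hx => ?_
  calc _ ≤ Real.exp (∑ j, ∑ i, Real.log (p i (x j i))) :=
        Real.exp_le_exp.2 (by linarith [(abs_le.1 (abs_sum_log_sub_le hx)).1])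
    _ = ∏ j, ∏ i, p i (x j i) := by simp_rw [Real.exp_sum, Real.exp_log (hpos _ _)]

/-- The permutation averages along an approximating sequence are comparable with those of the
typical vectors. -/
theorem exists_typicalSet_permAverage_le (hR : 0 < R)
    (hp : ∀ i, HasEntropyDensity (μ i : Measure (SymInterval R)) (p i))
    (h : C(Fin n → SymInterval R, ℝ)) {Ξ : (N : ℕ) → Fin n → Fin N → SymInterval R}
    (hΞ : IsApproximatingSequence Ξ μ) {ε : ℝ} (hε : 0 < ε) :
    ∃ (T : Finset ℝ) (η : ℝ), 0 < η ∧ η ≤ ε ∧ ∀ᶠ N in atTop, ∀ x ∈ typicalSet μ p T η N,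
      permAverage h (Ξ N) ≤ Real.exp (N * ε) * permAverage h (fun i j => x j i) ∧
      permAverage h (fun i j => x j i) ≤ Real.exp (N * ε) * permAverage h (Ξ N) := by
  obtain ⟨T, η, hη, H⟩ := exists_mesh_permAverage_le hR h hε
  -- The mesh tolerance η is split between the typical vectors and the approximating sequence; the
  -- bound by ε controls the entropy term.
  refine ⟨T, min (η / 2) ε, by positivity, min_le_right _ _, ?_⟩
  have hev : ∀ᶠ N in atTop, ∀ (i : Fin n) (t : T), |meanValue (fun j => leIndicator t (Ξ N i j))
      - ∫ x, leIndicator t x ∂(μ i : Measure (SymInterval R))| < η / 2 := by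
    refine eventually_all.2 fun i => eventually_all.2 fun t => ?_
    exact Metric.tendsto_nhds.1 (tendsto_meanValue_leIndicator (hΞ.tendsto_moment i)
      ((hp i).measure_coe_eq t)) (η / 2) (half_pos hη)
  filter_upwards [hev] with N hN x hx
  have key : ∀ i, ∀ t ∈ T, |∑ j, leIndicator t (Ξ N i j) - ∑ j, leIndicator t (x j i)|
      ≤ N * η := by
    intro i t ht
    have h1 := hN i ⟨t, ht⟩
    have h2 : |meanValue (fun j => leIndicator t (x j i))
        - ∫ x, leIndicator t x ∂(μ i : Measure (SymInterval R))| ≤ η / 2 :=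
      (hx (some (i, ⟨t, ht⟩))).trans (min_le_left _ _)
    rw [← natCast_mul_meanValue, ← natCast_mul_meanValue, ← mul_sub, abs_mul, Nat.abs_cast]
    gcongr
    rw [abs_lt] at h1
    rw [abs_le] at h2 ⊢
    constructor <;> linarith [h1.1, h1.2, h2.1, h2.2]
  exact ⟨H N _ _ key, H N _ _ fun i t ht => abs_sub_comm (∑ j, leIndicator t (Ξ N i j)) _ ▸
    key i t ht⟩

end Typical

/-! ### Bounds for the mutual pressure -/

section Bounds

variable {R : ℝ} {n : ℕ} {μ : Fin n → ProbabilityMeasure (SymInterval R)}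
  {p : Fin n → SymInterval R → ℝ} {Ξ : (N : ℕ) → Fin n → Fin N → SymInterval R}

theorem integral_exp_sum {N : ℕ} (h : C(Fin n → SymInterval R, ℝ)) :
    ∫ x : Fin N → Fin n → SymInterval R, Real.exp (∑ j, h (x j))
      = (∫ y, Real.exp (h y)) ^ N := by
  simp_rw [Real.exp_sum]
  rw [integral_fintype_prod_volume_eq_pow (ι := Fin N)
    (fun y : Fin n → SymInterval R => Real.exp (h y)), Fintype.card_fin]

/-- Integrating the comparison over the typical set bounds Ψ times its volume by e^{Nε/3} Z^N, and
that volume is at least e^{-N(L+η)} / 2. The three parts of ε pay for the comparison, for η, and for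
the factor 2. -/
theorem eventually_log_permAverage_le (hR : 0 < R)
    (hp : ∀ i, HasEntropyDensity (μ i : Measure (SymInterval R)) (p i))
    (h : C(Fin n → SymInterval R, ℝ)) (hΞ : IsApproximatingSequence Ξ μ) {ε : ℝ} (hε : 0 < ε) :
    ∀ᶠ N : ℕ in atTop, (1 / (N : ℝ)) * Real.log (permAverage h (Ξ N))
      ≤ pressure h + (∑ i, ∫ x, p i x * Real.log (p i x)) + ε := by
  set L := ∑ i, ∫ x, p i x * Real.log (p i x) with hL
  have hε3 : 0 < ε / 3 := by positivity
  obtain ⟨T, η, hη, hηε, hcomp⟩ := exists_typicalSet_permAverage_le hR hp h hΞ hε3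
  have hhalf := eventually_half_le_measure_typicalSet hp
    (Measure.pi fun i => (μ i : Measure (SymInterval R)))
    (fun i => ((measurePreserving_eval (fun i => (μ i : Measure (SymInterval R))) i).map_eq).symm)
    T hη
  have hlarge : ∀ᶠ N : ℕ in atTop, Real.log 2 / (ε / 3) ≤ (N : ℝ) :=
    tendsto_natCast_atTop_atTop.eventually_ge_atTop _
  filter_upwards [hcomp, hhalf, hlarge, eventually_gt_atTop 0] with N hcomp hhalf hlarge hN
  have hN' : (0 : ℝ) < N := by exact_mod_cast hN
  rw [div_le_iff₀ hε3] at hlarge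
  have hC := measurableSet_typicalSet hp T η N
  set C := typicalSet μ p T η N
  have hZ : 0 < ∫ y, Real.exp (h y) := integral_exp_cube_pos hR h.continuous
  have hΨ := permAverage_pos h (Ξ N)
  have h1 : (volume : Measure (Fin N → Fin n → SymInterval R)).real C * permAverage h (Ξ N)
      ≤ Real.exp (N * (ε / 3)) * (∫ y, Real.exp (h y)) ^ N := by
    calc (volume : Measure (Fin N → Fin n → SymInterval R)).real C * permAverage h (Ξ N)
        = ∫ x in C, permAverage h (Ξ N) := by rw [setIntegral_const, smul_eq_mul]
      _ ≤ ∫ x in C, Real.exp (N * (ε / 3)) * permAverage h (fun i j => x j i) :=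
          setIntegral_mono_on (integrable_const _)
            ((integrable_permAverage h).const_mul _).integrableOn hC fun x hx => (hcomp x hx).1
      _ = Real.exp (N * (ε / 3)) * ∫ x in C, Real.exp (∑ j, h (x j)) := by
          rw [integral_const_mul, setIntegral_permAverage h hC (mem_typicalSet_permute T η N)]
      _ ≤ Real.exp (N * (ε / 3)) * (∫ y, Real.exp (h y)) ^ N := by
          rw [← integral_exp_sum]
          exact mul_le_mul_of_nonneg_left (setIntegral_le_integral
            (integrable_of_continuous (by fun_prop)) (ae_of_all _ fun x => (Real.exp_pos _).le))
            (Real.exp_pos _).le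
  have h2 := hhalf.trans (measure_typicalSet_le hp T η N)
  rw [← hL] at h2
  have h3 : permAverage h (Ξ N) ≤ 2 * (Real.exp (N * (L + η)) * (Real.exp (N * (ε / 3))
      * (∫ y, Real.exp (h y)) ^ N)) := by
    have h4 := mul_le_mul_of_nonneg_left h1 (Real.exp_pos (N * (L + η))).le
    have h5 := mul_le_mul_of_nonneg_right h2 hΨ.le
    linarith
  have h6 := Real.log_le_log hΨ h3
  rw [Real.log_mul two_ne_zero (by positivity), Real.log_mul (by positivity) (by positivity),
    Real.log_mul (by positivity) (by positivity), Real.log_exp, Real.log_exp, Real.log_pow] at h6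
  rw [one_div, inv_mul_le_iff₀ hN']
  have h7 : (N : ℝ) * η ≤ N * (ε / 3) := by gcongr
  rw [pressure]
  linarith

theorem mutualPressure_le_of_eventually {h : C(Fin n → SymInterval R, ℝ)} {c : ℝ}
    (H : ∀ ε > 0, ∀ᶠ N : ℕ in atTop, (1 / (N : ℝ)) * Real.log (permAverage h (Ξ N)) ≤ c + ε) :
    mutualPressure h Ξ ≤ (c : EReal) := by
  refine EReal.le_of_forall_lt_iff_le.1 fun z hz => ?_
  have hz' : c < z := by exact_mod_cast hz
  refine limsup_le_of_le (by isBoundedDefault) ?_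
  filter_upwards [H (z - c) (sub_pos.2 hz')] with N hN
  exact EReal.coe_le_coe_iff.2 (hN.trans_eq (by ring))

theorem le_mutualPressure_of_eventually {h : C(Fin n → SymInterval R, ℝ)} {c : ℝ}
    (H : ∀ ε > 0, ∀ᶠ N : ℕ in atTop, c - ε ≤ (1 / (N : ℝ)) * Real.log (permAverage h (Ξ N))) :
    (c : EReal) ≤ mutualPressure h Ξ := by
  refine EReal.ge_of_forall_gt_iff_ge.1 fun z hz => ?_
  have hz' : z < c := by exact_mod_cast hz
  refine le_limsup_of_frequently_le (Eventually.frequently ?_) (by isBoundedDefault)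
  filter_upwards [H (c - z) (sub_pos.2 hz')] with N hN
  exact EReal.coe_le_coe_iff.2 (le_of_eq_of_le (by ring) hN)

theorem mutualPressure_le (hR : 0 < R)
    (hp : ∀ i, HasEntropyDensity (μ i : Measure (SymInterval R)) (p i))
    (h : C(Fin n → SymInterval R, ℝ)) (hΞ : IsApproximatingSequence Ξ μ) :
    mutualPressure h Ξ
      ≤ ((pressure h + ∑ i, ∫ x, p i x * Real.log (p i x) : ℝ) : EReal) :=
  mutualPressure_le_of_eventually fun _ hε => eventually_log_permAverage_le hR hp h hΞ hε

theorem isProbabilityMeasure_gibbsMeasure (hR : 0 < R) {ι : Type*} [Fintype ι]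
    {h : (ι → SymInterval R) → ℝ} (hh : Continuous h) : IsProbabilityMeasure (gibbsMeasure h) := by
  have := neZero_volume_cube hR ι
  exact isProbabilityMeasure_tilted (integrable_of_continuous (Real.continuous_exp.comp hh))

theorem pi_gibbsMeasure_real (hR : 0 < R) (h : C(Fin n → SymInterval R, ℝ)) {N : ℕ}
    {C : Set (Fin N → Fin n → SymInterval R)} (hC : MeasurableSet C) :
    (∫ y, Real.exp (h y)) ^ N * (Measure.pi fun _ : Fin N => gibbsMeasure h).real C
      = ∫ x in C, Real.exp (∑ j, h (x j)) := by
  have hZ : 0 < ∫ y, Real.exp (h y) := integral_exp_cube_pos hR h.continuous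
  have hcont : Continuous fun y => Real.exp (h y) / ∫ y, Real.exp (h y) := by fun_prop
  have h1 := pi_withDensity_ofReal (ι := Fin N)
    (fun _ => (volume : Measure (Fin n → SymInterval R)))
    (q := fun _ y => Real.exp (h y) / ∫ y, Real.exp (h y)) (fun _ y => by positivity)
    (fun _ => integrable_of_continuous hcont)
  have h2 : (Measure.pi fun _ : Fin N => gibbsMeasure h)
      = (volume : Measure (Fin N → Fin n → SymInterval R)).withDensity
        fun x => ENNReal.ofReal (∏ j, Real.exp (h (x j)) / ∫ y, Real.exp (h y)) := h1
  have h3 : ∀ x : Fin N → Fin n → SymInterval R, ∏ j, Real.exp (h (x j)) / ∫ y, Real.exp (h y)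
      = Real.exp (∑ j, h (x j)) / (∫ y, Real.exp (h y)) ^ N := fun x => by
    rw [Finset.prod_div_distrib, Real.exp_sum, Finset.prod_const, Finset.card_univ,
      Fintype.card_fin]
  simp_rw [h3] at h2
  rw [h2, withDensity_ofReal_real (fun x => by positivity)
    (integrable_of_continuous (by fun_prop)) hC, integral_div]
  field_simp

/-- Samples of the Gibbs measure are eventually typical with probability at least 1/2, so the
typical set carries at least half of Z^N, while its volume is at most e^{-N(L-η)}. -/
theorem le_mutualPressure (hR : 0 < R)
    (hp : ∀ i, HasEntropyDensity (μ i : Measure (SymInterval R)) (p i))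
    (hpos : ∀ i x, 0 < p i x) (h : C(Fin n → SymInterval R, ℝ))
    (hμ : ∀ i, (μ i : Measure (SymInterval R)) = (gibbsMeasure h).map (fun x => x i))
    (hΞ : IsApproximatingSequence Ξ μ) :
    ((pressure h + ∑ i, ∫ x, p i x * Real.log (p i x) : ℝ) : EReal) ≤ mutualPressure h Ξ := by
  refine le_mutualPressure_of_eventually fun ε hε => ?_
  set L := ∑ i, ∫ x, p i x * Real.log (p i x) with hL
  have hε3 : 0 < ε / 3 := by positivity
  have := isProbabilityMeasure_gibbsMeasure hR h.continuous
  obtain ⟨T, η, hη, hηε, hcomp⟩ := exists_typicalSet_permAverage_le hR hp h hΞ hε3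
  have hhalf := eventually_half_le_measure_typicalSet hp (gibbsMeasure h) hμ T hη
  have hlarge : ∀ᶠ N : ℕ in atTop, Real.log 2 / (ε / 3) ≤ (N : ℝ) :=
    tendsto_natCast_atTop_atTop.eventually_ge_atTop _
  filter_upwards [hcomp, hhalf, hlarge, eventually_gt_atTop 0] with N hcomp hhalf hlarge hN
  have hN' : (0 : ℝ) < N := by exact_mod_cast hN
  rw [div_le_iff₀ hε3] at hlarge
  have hC := measurableSet_typicalSet hp T η N
  have hvol := volume_typicalSet_le hp hpos T η N
  set C := typicalSet μ p T η N
  have hZ : 0 < ∫ y, Real.exp (h y) := integral_exp_cube_pos hR h.continuous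
  have hΨ := permAverage_pos h (Ξ N)
  have h1 : (∫ y, Real.exp (h y)) ^ N * (1 / 2)
      ≤ (volume : Measure (Fin N → Fin n → SymInterval R)).real C
        * (Real.exp (N * (ε / 3)) * permAverage h (Ξ N)) := by
    calc (∫ y, Real.exp (h y)) ^ N * (1 / 2)
        ≤ (∫ y, Real.exp (h y)) ^ N * (Measure.pi fun _ : Fin N => gibbsMeasure h).real C := by
          gcongr
      _ = ∫ x in C, permAverage h (fun i j => x j i) := by
          rw [pi_gibbsMeasure_real hR h hC,
            setIntegral_permAverage h hC (mem_typicalSet_permute T η N)]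
      _ ≤ ∫ x in C, Real.exp (N * (ε / 3)) * permAverage h (Ξ N) :=
          setIntegral_mono_on (integrable_permAverage h).integrableOn (integrable_const _) hC
            fun x hx => (hcomp x hx).2
      _ = _ := by rw [setIntegral_const, smul_eq_mul]
  rw [← hL] at hvol
  have h3 : Real.exp (N * (L - η)) * (∫ y, Real.exp (h y)) ^ N
      ≤ 2 * (Real.exp (N * (ε / 3)) * permAverage h (Ξ N)) := by
    have h4 := mul_le_mul_of_nonneg_left h1 (Real.exp_pos (N * (L - η))).le
    have h5 := mul_le_mul_of_nonneg_right hvol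
      (mul_pos (Real.exp_pos (N * (ε / 3))) hΨ).le
    linarith
  have h6 := Real.log_le_log (by positivity) h3
  rw [Real.log_mul two_ne_zero (by positivity), Real.log_mul (by positivity) (by positivity),
    Real.log_mul (by positivity) (by positivity), Real.log_exp, Real.log_exp, Real.log_pow] at h6
  rw [one_div, le_inv_mul_iff₀ hN']
  have h7 : (N : ℝ) * η ≤ N * (ε / 3) := by gcongr
  rw [pressure]
  linarith

/-! ### The case of equality -/

/-- Adding f(x_i) multiplies every term of the permutation average by the same factor, the
exponential of the sum of f over the i-th vector, which is e^{N ∫ f dμ_i} up to e^{o(N)}. Combined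
with the upper bound for the perturbed potential, equality at `h` makes μ_i a subgradient of the
pressure. -/
theorem pressure_add_le_pressure (hR : 0 < R)
    (hp : ∀ i, HasEntropyDensity (μ i : Measure (SymInterval R)) (p i))
    (h : C(Fin n → SymInterval R, ℝ)) (hΞ : IsApproximatingSequence Ξ μ)
    (heq : ((pressure h + ∑ i, ∫ x, p i x * Real.log (p i x) : ℝ) : EReal) ≤ mutualPressure h Ξ)
    (i : Fin n) (f : C(SymInterval R, ℝ)) :
    pressure h + ∫ x, f x ∂(μ i : Measure (SymInterval R))
      ≤ pressure (h + f.comp (ContinuousMap.eval i)) := by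
  set L := ∑ i, ∫ x, p i x * Real.log (p i x) with hL
  set g := h + f.comp (ContinuousMap.eval i) with hg
  have key : mutualPressure h Ξ
      ≤ ((pressure g + L - ∫ x, f x ∂(μ i : Measure (SymInterval R)) : ℝ) : EReal) := by
    refine mutualPressure_le_of_eventually fun ε hε => ?_
    have h1 := eventually_log_permAverage_le hR hp g hΞ (half_pos hε)
    have h2 := Metric.tendsto_nhds.1
      (tendsto_meanValue_of_tendsto_moment (hΞ.tendsto_moment i) f) (ε / 2) (half_pos hε)
    filter_upwards [h1, h2, eventually_gt_atTop 0] with N h1 h2 hN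
    have hN' : (0 : ℝ) < N := by exact_mod_cast hN
    have h3 : permAverage h (Ξ N)
        ≤ Real.exp (-(N * meanValue fun j => f (Ξ N i j))) * permAverage g (Ξ N) := by
      refine permAverage_le_exp_mul fun σ => le_of_eq ?_
      have h4 : ∑ j, g (fun k => Ξ N k (σ k j))
          = ∑ j, h (fun k => Ξ N k (σ k j)) + ∑ j, f (Ξ N i (σ i j)) := by
        rw [← Finset.sum_add_distrib]; rfl
      rw [h4, natCast_mul_meanValue, Equiv.sum_comp (σ i) fun j => f (Ξ N i j)]
      ring
    have h5 := Real.log_le_log (permAverage_pos _ _) h3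
    rw [Real.log_mul (Real.exp_ne_zero _) (permAverage_pos _ _).ne', Real.log_exp] at h5
    rw [one_div, inv_mul_le_iff₀ hN'] at h1 ⊢
    rw [Real.dist_eq, abs_lt] at h2
    have h6 := mul_le_mul_of_nonneg_left h2.1.le hN'.le
    linarith
  have := EReal.coe_le_coe_iff.1 (heq.trans key)
  linarith

/-- For t f the subgradient inequality says that the moment generating function of f(x_i) under the
Gibbs measure is at least e^{ta}, where a = ∫ f dμ_i. The two agree at t = 0, so their difference
has a minimum there and the derivatives coincide. -/
theorem integral_comp_eval_gibbsMeasure_eq (hR : 0 < R)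
    (hp : ∀ i, HasEntropyDensity (μ i : Measure (SymInterval R)) (p i))
    (h : C(Fin n → SymInterval R, ℝ)) (hΞ : IsApproximatingSequence Ξ μ)
    (heq : ((pressure h + ∑ i, ∫ x, p i x * Real.log (p i x) : ℝ) : EReal) ≤ mutualPressure h Ξ)
    (i : Fin n) (f : C(SymInterval R, ℝ)) :
    ∫ y, f (y i) ∂(gibbsMeasure h) = ∫ x, f x ∂(μ i : Measure (SymInterval R)) := by
  have := isProbabilityMeasure_gibbsMeasure hR h.continuous
  set a := ∫ x, f x ∂(μ i : Measure (SymInterval R)) with ha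
  let F : (Fin n → SymInterval R) → ℝ := fun y => f (y i)
  have hF : Continuous F := by fun_prop
  have hmgf : ∀ t, Real.exp (t * a) ≤ ProbabilityTheory.mgf F (gibbsMeasure h) t := by
    intro t
    have h1 := pressure_add_le_pressure hR hp h hΞ heq i (t • f)
    have hZ : 0 < ∫ y, Real.exp (h y) := integral_exp_cube_pos hR h.continuous
    have h2 : ProbabilityTheory.mgf F (gibbsMeasure h) t
        = (∫ y, Real.exp ((h + (t • f).comp (ContinuousMap.eval i) :
          C(Fin n → SymInterval R, ℝ)) y)) / ∫ y, Real.exp (h y) :=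
      integral_exp_tilted h fun y => t * F y
    have h3 : ∫ x, (t • f) x ∂(μ i : Measure (SymInterval R)) = t * a := by
      rw [ha, ← integral_const_mul]; rfl
    rw [h3, pressure, pressure] at h1
    have h4 := Real.exp_le_exp.2 h1
    rw [Real.exp_add, Real.exp_log hZ, Real.exp_log
      (integral_exp_cube_pos hR (ContinuousMap.continuous _))] at h4
    rw [h2, le_div_iff₀ hZ]
    linarith
  have hset : ProbabilityTheory.integrableExpSet F (gibbsMeasure h) = Set.univ :=
    Set.eq_univ_of_forall fun t => integrable_of_continuous (by fun_prop)
  have hd1 : HasDerivAt (ProbabilityTheory.mgf F (gibbsMeasure h))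
      (∫ y, F y ∂(gibbsMeasure h)) 0 := by
    have := ProbabilityTheory.hasDerivAt_mgf (X := F) (μ := gibbsMeasure h) (t := 0)
      (by rw [hset]; simp)
    simpa using this
  have hd2 : HasDerivAt (fun t => Real.exp (t * a)) a 0 := by
    simpa using ((hasDerivAt_id (0 : ℝ)).mul_const a).exp
  have hmin : IsLocalMin (fun t => ProbabilityTheory.mgf F (gibbsMeasure h) t - Real.exp (t * a))
      0 := by
    refine Eventually.of_forall fun t => ?_
    have := hmgf t
    simpa using this
  have := hmin.hasDerivAt_eq_zero (hd1.sub hd2)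
  exact sub_eq_zero.1 this

theorem eq_map_gibbsMeasure (hR : 0 < R)
    (hp : ∀ i, HasEntropyDensity (μ i : Measure (SymInterval R)) (p i))
    (h : C(Fin n → SymInterval R, ℝ)) (hΞ : IsApproximatingSequence Ξ μ)
    (heq : ((pressure h + ∑ i, ∫ x, p i x * Real.log (p i x) : ℝ) : EReal) ≤ mutualPressure h Ξ)
    (i : Fin n) :
    (μ i : Measure (SymInterval R)) = (gibbsMeasure h).map (fun x => x i) := by
  have := isProbabilityMeasure_gibbsMeasure hR h.continuous
  have : IsProbabilityMeasure ((gibbsMeasure h).map (fun x => x i)) :=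
    Measure.isProbabilityMeasure_map (measurable_pi_apply i).aemeasurable
  refine ext_of_forall_integral_eq_of_IsFiniteMeasure fun f => ?_
  rw [integral_map (measurable_pi_apply i).aemeasurable f.continuous.aestronglyMeasurable]
  exact (integral_comp_eval_gibbsMeasure_eq hR hp h hΞ heq i f.toContinuousMap).symm

end Bounds

/-! ### Marginals of Gibbs measures -/

section Marginals

variable {R : ℝ} {n : ℕ}

/-- Splits off the i-th coordinate of the cube, as needed for Fubini; the block of indices equal to
`i` is a product over a one-point type. -/
theorem measurePreserving_glue (i : Fin n) :
    MeasurePreserving (((MeasurableEquiv.funUnique {j // j = i} (SymInterval R)).symm.prodCongr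
      (MeasurableEquiv.refl ({j : Fin n // j ≠ i} → SymInterval R))).trans
        (MeasurableEquiv.piEquivPiSubtypeProd (fun _ => SymInterval R) (fun j => j = i)).symm)
      (volume.prod volume) volume := by
  have h1 : MeasurePreserving (MeasurableEquiv.funUnique {j : Fin n // j = i} (SymInterval R)).symm
      volume volume := by
    convert (volume_preserving_funUnique {j : Fin n // j = i} (SymInterval R)).symm
  have h2 : MeasurePreserving
      (MeasurableEquiv.piEquivPiSubtypeProd (fun _ => SymInterval R) (fun j => j = i)).symm
      ((volume : Measure ({j : Fin n // j = i} → SymInterval R)).prod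
        (volume : Measure ({j : Fin n // j ≠ i} → SymInterval R))) volume := by
    simp only [volume_pi]
    convert (measurePreserving_piEquivPiSubtypeProd
      (fun _ : Fin n => (volume : Measure (SymInterval R))) (fun j => j = i)).symm <;> rfl
  exact h2.comp (h1.prod (MeasurePreserving.id _))

theorem continuous_glue (i : Fin n) :
    Continuous fun z : SymInterval R × ({j : Fin n // j ≠ i} → SymInterval R) =>
      fun j => if hj : j = i then z.1 else z.2 ⟨j, hj⟩ := by
  refine continuous_pi fun j => ?_
  by_cases hj : j = i
  · simpa [hj] using continuous_fst
  · simp only [hj, dite_false]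
    exact (continuous_apply (⟨j, hj⟩ : {j // j ≠ i})).comp continuous_snd

/-- Integration over a cylinder, first over the variables with index different from `i`. -/
theorem setIntegral_preimage_eval {g : (Fin n → SymInterval R) → ℝ} (hg : Continuous g)
    (i : Fin n) (s : Set (SymInterval R)) :
    ∫ y in (fun y => y i) ⁻¹' s, g y
      = ∫ x in s, ∫ y : {j : Fin n // j ≠ i} → SymInterval R,
        g (fun j => if hj : j = i then x else y ⟨j, hj⟩) := by
  have hmp := measurePreserving_glue (R := R) i
  rw [← hmp.setIntegral_preimage_emb (MeasurableEquiv.measurableEmbedding _)]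
  have hfun : ∀ z : SymInterval R × ({j : Fin n // j ≠ i} → SymInterval R),
      (((MeasurableEquiv.funUnique {j // j = i} (SymInterval R)).symm.prodCongr
      (MeasurableEquiv.refl ({j : Fin n // j ≠ i} → SymInterval R))).trans
        (MeasurableEquiv.piEquivPiSubtypeProd (fun _ => SymInterval R) (fun j => j = i)).symm) z
      = fun j => if hj : j = i then z.1 else z.2 ⟨j, hj⟩ := fun z => rfl
  have hpre : (((MeasurableEquiv.funUnique {j // j = i} (SymInterval R)).symm.prodCongr
      (MeasurableEquiv.refl ({j : Fin n // j ≠ i} → SymInterval R))).trans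
        (MeasurableEquiv.piEquivPiSubtypeProd (fun _ => SymInterval R) (fun j => j = i)).symm) ⁻¹'
        ((fun y => y i) ⁻¹' s) = s ×ˢ Set.univ := by
    ext z
    simp [hfun]
  rw [hpre, setIntegral_prod]
  · simp only [hfun, Measure.restrict_univ]
  · simp only [hfun]
    exact (integrable_of_continuous (hg.comp (continuous_glue i))).integrableOn

theorem exp_marginalPotential (hR : 0 < R) (h : C(Fin n → SymInterval R, ℝ)) (i : Fin n)
    (x : SymInterval R) :
    Real.exp (marginalPotential h i x) = ∫ y : {j : Fin n // j ≠ i} → SymInterval R,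
      Real.exp (h (fun j => if hj : j = i then x else y ⟨j, hj⟩)) :=
  Real.exp_log (integral_exp_cube_pos hR
    (h.continuous.comp ((continuous_glue i).comp (Continuous.prodMk_right x))))

theorem continuous_marginalPotential (hR : 0 < R) (h : C(Fin n → SymInterval R, ℝ)) (i : Fin n) :
    Continuous (marginalPotential h i) := by
  have hc : Continuous fun x : SymInterval R => ∫ y : {j : Fin n // j ≠ i} → SymInterval R,
      Real.exp (h (fun j => if hj : j = i then x else y ⟨j, hj⟩)) := by
    have := continuous_parametric_integral_of_continuous
      (μ := (volume : Measure ({j : Fin n // j ≠ i} → SymInterval R)))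
      (f := fun (x : SymInterval R) (y : {j : Fin n // j ≠ i} → SymInterval R) =>
        Real.exp (h (fun j => if hj : j = i then x else y ⟨j, hj⟩)))
      (Real.continuous_exp.comp (h.continuous.comp (continuous_glue i))) isCompact_univ
    simpa using this
  refine hc.log fun x => ?_
  rw [← exp_marginalPotential hR]
  exact Real.exp_ne_zero _

/-- The marginals of a Gibbs measure are the Gibbs measures of the marginal potentials. -/
theorem map_gibbsMeasure (hR : 0 < R) (h : C(Fin n → SymInterval R, ℝ)) (i : Fin n) :
    (gibbsMeasure h).map (fun x => x i) = gibbsMeasure (marginalPotential h i) := by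
  have key : ∀ s : Set (SymInterval R), ∫ y in (fun y => y i) ⁻¹' s, Real.exp (h y)
      = ∫ x in s, Real.exp (marginalPotential h i x) := fun s => by
    simp_rw [exp_marginalPotential hR]
    exact setIntegral_preimage_eval (Real.continuous_exp.comp h.continuous) i s
  have hZ : ∫ y, Real.exp (h y) = ∫ x, Real.exp (marginalPotential h i x) := by
    simpa using key Set.univ
  ext s hs
  have hm : Measurable fun y : Fin n → SymInterval R => y i := measurable_pi_apply i
  rw [Measure.map_apply hm hs, gibbsMeasure, gibbsMeasure,
    tilted_apply_eq_ofReal_integral' _ (hm hs), tilted_apply_eq_ofReal_integral' _ hs,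
    integral_div, integral_div, key, hZ]

theorem hasEntropyDensity_gibbsMeasure (hR : 0 < R) {f : SymInterval R → ℝ} (hf : Continuous f) :
    HasEntropyDensity (gibbsMeasure f) (fun x => Real.exp (f x) / ∫ x, Real.exp (f x)) ∧
      ∀ x, 0 < Real.exp (f x) / ∫ x, Real.exp (f x) := by
  have hne : NeZero (volume : Measure (SymInterval R)) := ⟨fun h0 => by
    have h1 : (volume : Measure (SymInterval R)) Set.univ = 0 := by rw [h0]; simp
    rw [volume_symInterval_univ, ENNReal.ofReal_eq_zero] at h1
    linarith⟩
  have hZ : 0 < ∫ x, Real.exp (f x) :=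
    integral_exp_pos (integrable_of_continuous (Real.continuous_exp.comp hf))
  have hpos : ∀ x, 0 < Real.exp (f x) / ∫ x, Real.exp (f x) := fun x => by positivity
  have hc : Continuous fun x => Real.exp (f x) / ∫ x, Real.exp (f x) := by fun_prop
  exact ⟨⟨hc.measurable, fun x => (hpos x).le, rfl,
    integrable_of_continuous (hc.mul (hc.log fun x => (hpos x).ne'))⟩, hpos⟩

end Marginals

/-! ### Existence of approximating sequences -/

/-- Independent samples of μ_i almost surely have all their countably many empirical moments
converging. Sorting the first N samples does not change these moments. -/
theorem exists_isApproximatingSequence {R : ℝ} {n : ℕ}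
    (μ : Fin n → ProbabilityMeasure (SymInterval R)) :
    ∃ Ξ : (N : ℕ) → Fin n → Fin N → SymInterval R, IsApproximatingSequence Ξ μ := by
  have hω : ∀ i, ∃ ω : ℕ → SymInterval R, ∀ k : ℕ,
      Tendsto (fun N : ℕ => (1 / (N : ℝ)) * ∑ j : Fin N, (ω j : ℝ) ^ k) atTop
        (𝓝 (∫ x, (x : ℝ) ^ k ∂(μ i : Measure (SymInterval R)))) := by
    intro i
    have h1 : ∀ᵐ ω ∂(Measure.infinitePi fun _ : ℕ => (μ i : Measure (SymInterval R))), ∀ k : ℕ,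
        Tendsto (fun N : ℕ => (1 / (N : ℝ)) * ∑ j : Fin N, (ω j : ℝ) ^ k) atTop
          (𝓝 (∫ x, (x : ℝ) ^ k ∂(μ i : Measure (SymInterval R)))) := by
      refine ae_all_iff.2 fun k => ?_
      have hc : Continuous fun x : SymInterval R => (x : ℝ) ^ k := by fun_prop
      exact ae_tendsto_average (μ i : Measure (SymInterval R)) hc.measurable
        (integrable_of_continuous hc)
    exact h1.exists
  choose ω hω using hω
  let v : (N : ℕ) → Fin n → Fin N → SymInterval R := fun N i j => ω i j
  refine ⟨fun N i => v N i ∘ Tuple.sort (v N i), fun N i => Tuple.monotone_sort (v N i),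
    fun i k => (hω i k).congr fun N => ?_⟩
  unfold meanValue
  congr 1
  exact (Equiv.sum_comp (Tuple.sort (v N i)) fun j => (v N i j : ℝ) ^ k).symm

/-! ### The main theorem -/

theorem sum_entropy_eq_bot {R : ℝ} {n : ℕ} {μ : Fin n → ProbabilityMeasure (SymInterval R)}
    {i : Fin n} (hi : entropy (μ i) = ⊥) : ∑ i, entropy (μ i) = ⊥ := by
  rw [← Finset.add_sum_erase _ _ (Finset.mem_univ i), hi, EReal.bot_add]

theorem sum_entropy_eq {R : ℝ} {n : ℕ} {μ : Fin n → ProbabilityMeasure (SymInterval R)}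
    {p : Fin n → SymInterval R → ℝ}
    (hp : ∀ i, HasEntropyDensity (μ i : Measure (SymInterval R)) (p i)) :
    ∑ i, entropy (μ i) = ((-∑ i, ∫ x, p i x * Real.log (p i x) : ℝ) : EReal) := by
  have hcoe : ∀ f : Fin n → ℝ, ((∑ i, f i : ℝ) : EReal) = ∑ i, (f i : EReal) := fun f =>
    map_sum (⟨⟨Real.toEReal, EReal.coe_zero⟩, EReal.coe_add⟩ : ℝ →+ EReal) f Finset.univ
  rw [← Finset.sum_neg_distrib, hcoe]
  exact Finset.sum_congr rfl fun i _ => entropy_eq_of_hasEntropyDensity (hp i)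

theorem theorem3p2 {R : ℝ} (hR : 0 < R) {n : ℕ} (h : C(Fin n → SymInterval R, ℝ))
    (μ : Fin n → ProbabilityMeasure (SymInterval R)) :
    (∃ Ξ : (N : ℕ) → Fin n → Fin N → SymInterval R, IsApproximatingSequence Ξ μ) ∧
    (∀ i, Continuous (marginalPotential h i)) ∧
    ∀ Ξ : (N : ℕ) → Fin n → Fin N → SymInterval R, IsApproximatingSequence Ξ μ →
      mutualPressure h Ξ + ∑ i, entropy (μ i) ≤ (pressure h : EReal) ∧
      List.TFAE [
        (pressure h : EReal) = mutualPressure h Ξ + ∑ i, entropy (μ i),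
        ∀ i, (μ i : Measure (SymInterval R)) = (gibbsMeasure h).map (fun x => x i),
        ∀ i, (μ i : Measure (SymInterval R)) = gibbsMeasure (marginalPotential h i)] := by
  refine ⟨exists_isApproximatingSequence μ, continuous_marginalPotential hR h, fun Ξ hΞ => ?_⟩
  have hle : mutualPressure h Ξ + ∑ i, entropy (μ i) ≤ (pressure h : EReal) := by
    -- In `EReal` the value `⊥` absorbs every summand, even `⊤`, so one infinite entropy makes the
    -- left side `⊥`.
    by_cases hbot : ∃ i, entropy (μ i) = ⊥
    · obtain ⟨i, hi⟩ := hbot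
      rw [sum_entropy_eq_bot hi, EReal.add_bot]
      exact bot_le
    · choose p hp using fun i => exists_hasEntropyDensity (not_exists.1 hbot i)
      rw [sum_entropy_eq hp]
      refine (add_le_add_left (mutualPressure_le hR hp h hΞ) _).trans_eq ?_
      rw [← EReal.coe_add]
      congr 1
      ring
  refine ⟨hle, ?_⟩
  tfae_have 2 ↔ 3 := forall_congr' fun i => by rw [map_gibbsMeasure hR]
  tfae_have 1 → 2 := by
    intro heq
    -- The pressure is a real number, so equality forces all the entropies to be finite and
    -- densities to exist.
    have hbot : ∀ i, entropy (μ i) ≠ ⊥ := fun i hi => by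
      rw [sum_entropy_eq_bot hi, EReal.add_bot] at heq
      exact EReal.coe_ne_bot _ heq
    choose p hp using fun i => exists_hasEntropyDensity (hbot i)
    refine eq_map_gibbsMeasure hR hp h hΞ (le_of_eq ?_)
    rw [EReal.coe_add, heq, sum_entropy_eq hp, add_assoc, ← EReal.coe_add, neg_add_cancel,
      EReal.coe_zero, add_zero]
  tfae_have 2 → 1 := by
    intro h2
    have h3 := fun i => (h2 i).trans (map_gibbsMeasure hR h i)
    refine le_antisymm ?_ hle
    have hp : ∀ i, HasEntropyDensity (μ i : Measure (SymInterval R)) _ := fun i =>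
      (h3 i).symm ▸ (hasEntropyDensity_gibbsMeasure hR (continuous_marginalPotential hR h i)).1
    have hB := le_mutualPressure hR hp (fun i =>
      (hasEntropyDensity_gibbsMeasure hR (continuous_marginalPotential hR h i)).2) h h2 hΞ
    rw [sum_entropy_eq hp]
    refine le_of_eq_of_le ?_ (add_le_add_left hB _)
    rw [← EReal.coe_add]
    congr 1
    ring
  tfae_finish
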